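/- Let $d\ge 1$ be an integer, $\beta>0$, $R\in(0,1)$, $\varphi\in(0,1)$ and $X_*\in\mathbb R^d$. Let $\mathbb Q$ be the distribution of a pair $(X,Y)\in\mathbb R^d\times\{0,1\}$, where $X$ has a Lebesgue density $\mu$ and $\eta(X)=\mathbb P(Y=1\mid X)$. Write $\lfloor x\rfloor$ for the largest integer $m\ge 0$ that is strictly smaller than $x>0$, and put $\omega=\lfloor\beta/2\rfloor$ and $\tilde r_n=n^{-1/(d+2\beta)}$. Let $\mathcal D_n=\{(X_i,Y_i)\}_{i=1}^n$ be i.i.d. with distribution $\mathbb Q$. Let $X_{(1)},\dots,X_{(n)}$ be the covariates ordered by their distance to $X_*$, with corresponding labels $Y_{(1)},\dots,Y_{(n)}$, and let $r_i=\|X_{(i)}-X_*\|_2$ and $N_n=\#\{i: r_i\le\tilde r_n\}$. Let $\tilde R_n$ be the $N_n\times\omega$ matrix with $i$-th row $(r_i^2,r_i^4,\dots,r_i^{2\omega})$, and let $\zeta_n=\langle 1,\tilde R_n(\tilde R_n^\top\tilde R_n)^{-1}\tilde R_n^\top 1\rangle$ with $1=(1,\dots,1)^\top\in\mathbb R^{N_n}$.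 Assume: (C-1) $\mu\ge l$ on the closed ball $B_R(X_*)$ for some constant $l>0$. (C-2) Each $f\in\{\mu,\eta\mu\}$ is $\beta$-Hölder over $B_R(X_*)$ in the following sense: there are a polynomial $b:\mathbb R^d\to\mathbb R$ of degree at most $\lfloor\beta\rfloor$ with $b(0)=0$ and a constant $L\in(0,\infty)$ such that $|f(X)-f(X_*)-b(X-X_*)|\le L\|X-X_*\|_2^\beta$ for all $X\in B_R(X_*)$. (C-3) There are $c,C',\tau>0$ such that $\mathbb P(\zeta_n\ge\varphi N_n)\le C'\exp(-c\,n^\tau)$ for all $n\ge1$. The local radial regression (LRR) estimator $\hat\eta_n(X_*)$ is defined as follows. If $N_n\ge 1+\omega$ and $\zeta_n\le\varphi N_n$, then $\hat\eta_n(X_*)=\hat f_n(0)$, where $\hat f_n$ minimizes $\sum_{i=1}^n w_n(r_i)\{Y_{(i)}-f(r_i)\}^2$ over all $f(r)=\theta_0+\sum_{c=1}^{\omega}\theta_c r^{2c}$ with $\theta_0,\dots,\theta_\omega\in\mathbb R$, with weights $w_n(r)=1/N_n$ for $r\le\tilde r_n$ and $w_n(r)=0$ for $r>\tilde r_n$.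 Otherwise $\hat\eta_n(X_*)=0$. Then there is a constant $C>0$, not depending on $n$, such that for all $n\ge1$ $$\mathbb E_{\mathcal D_n}\big(\{\eta(X_*)-\hat\eta_n(X_*)\}^2\big)\le C\,n^{-2\beta/(d+2\beta)}.$$ -/

import Mathlib

open MeasureTheory ProbabilityTheory
open scoped Matrix

noncomputable section

namespace LocalRadial

/-- `⌊β⌋` in the convention of strict floors: the largest natural number strictly below `β`
(for `β > 0`), e.g. `3` for `β = 3.4` and `2` for `β = 3`. -/
def strictFloor (β : ℝ) : ℕ := ⌈β⌉₊ - 1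

lemma isGreatest_strictFloor {β : ℝ} (hβ : 0 < β) :
    IsGreatest {m : ℕ | (m : ℝ) < β} (strictFloor β) := by
  have h1 : 0 < ⌈β⌉₊ := Nat.ceil_pos.mpr hβ
  refine ⟨?_, fun m hm => ?_⟩
  · have h2 : ⌈β⌉₊ - 1 < ⌈β⌉₊ := by omega
    exact Nat.lt_ceil.mp h2
  · have h2 : m < ⌈β⌉₊ := Nat.lt_ceil.mpr hm
    unfold strictFloor
    omega

/-- The covariate space `ℝ^d` with its Euclidean norm. -/
abbrev Cov (d : ℕ) : Type := EuclideanSpace ℝ (Fin d)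

/-- A data set `(X_1, Y_1), …, (X_n, Y_n)`. -/
abbrev Data (d n : ℕ) : Type := Fin n → Cov d × ℝ

/-- The law of a data set of `n` independent pairs with common distribution `Q`. -/
abbrev dataLaw {d : ℕ} (Q : Measure (Cov d × ℝ)) (n : ℕ) : Measure (Data d n) :=
  Measure.pi fun _ : Fin n => Q

/-- `Q` is the distribution of a pair `(X, Y)` with `Y ∈ {0, 1}`, `X` has the Lebesgue density `μ`,
and `η` is the label probability `η(X) = P(Y = 1 | X)`. -/
structure IsLabelModel {d : ℕ} (Q : Measure (Cov d × ℝ)) (μ η : Cov d → ℝ) : Prop where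
  label : ∀ᵐ z ∂Q, z.2 = 0 ∨ z.2 = 1
  density_measurable : Measurable μ
  density_nonneg : ∀ x, 0 ≤ μ x
  density : Q.map Prod.fst = volume.withDensity fun x => ENNReal.ofReal (μ x)
  prob_measurable : Measurable η
  prob : Q⟦{z | z.2 = 1} | MeasurableSpace.comap Prod.fst inferInstance⟧ =ᵐ[Q] fun z => η z.1

/-- On the closed ball of radius `R` around `x₀`, `f` is bounded below by a positive constant. -/
def LowerBoundedOnBall {d : ℕ} (x₀ : Cov d) (R : ℝ) (f : Cov d → ℝ) : Prop :=
  ∃ l : ℝ, 0 < l ∧ ∀ x ∈ Metric.closedBall x₀ R, l ≤ f x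

/-- On the closed ball of radius `R` around `x₀`, `f` is `β`-Hölder in the sense of its expansion
at `x₀`: `f x = f x₀ + b (x - x₀) + ε x` with a polynomial `b` of degree at most `⌊β⌋`
(strict floor), `b 0 = 0`, and `|ε x| ≤ L ‖x - x₀‖ ^ β`. -/
def HolderOnBall {d : ℕ} (β : ℝ) (x₀ : Cov d) (R : ℝ) (f : Cov d → ℝ) : Prop :=
  ∃ b : MvPolynomial (Fin d) ℝ, b.totalDegree ≤ strictFloor β ∧
    MvPolynomial.eval (fun _ => (0 : ℝ)) b = 0 ∧
    ∃ L : ℝ, 0 < L ∧ ∀ x ∈ Metric.closedBall x₀ R,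
      |f x - f x₀ - MvPolynomial.eval (fun j => x j - x₀ j) b| ≤ L * ‖x - x₀‖ ^ β

/-- The radial distance `‖X_i - x₀‖` of the `i`-th observation. -/
def radial {d n : ℕ} (x₀ : Cov d) (D : Data d n) (i : Fin n) : ℝ := ‖(D i).1 - x₀‖

/-- The indices of the observations with `‖X_i - x₀‖ ≤ r`. -/
def inBall {d n : ℕ} (x₀ : Cov d) (r : ℝ) (D : Data d n) : Finset (Fin n) :=
  Finset.univ.filter fun i => radial x₀ D i ≤ r

/-- `N_n`, the number of observations in the ball of radius `r`. -/
def numInBall {d n : ℕ} (x₀ : Cov d) (r : ℝ) (D : Data d n) : ℕ := (inBall x₀ r D).card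

/-- The matrix with rows `(r_i ^ 2, r_i ^ 4, …, r_i ^ (2 ω))`, one for each of the `N_n`
observations in the ball. The rows carry the original indices instead of those sorted by distance;
everything below is invariant under permutations of the rows. -/
def radialMatrix {d n : ℕ} (ω : ℕ) (x₀ : Cov d) (r : ℝ) (D : Data d n) :
    Matrix (inBall x₀ r D) (Fin ω) ℝ :=
  Matrix.of fun i c => radial x₀ D i ^ (2 * ((c : ℕ) + 1))

/-- The projection `𝒫 = R (Rᵀ R)⁻¹ Rᵀ` for the matrix `R` above. -/
def radialProj {d n : ℕ} (ω : ℕ) (x₀ : Cov d) (r : ℝ) (D : Data d n) :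
    Matrix (inBall x₀ r D) (inBall x₀ r D) ℝ :=
  radialMatrix ω x₀ r D * ((radialMatrix ω x₀ r D)ᵀ * radialMatrix ω x₀ r D)⁻¹ *
    (radialMatrix ω x₀ r D)ᵀ

/-- `ζ_n = ⟨1, 𝒫 1⟩`. -/
def zeta {d n : ℕ} (ω : ℕ) (x₀ : Cov d) (r : ℝ) (D : Data d n) : ℝ :=
  (fun _ => (1 : ℝ)) ⬝ᵥ (radialProj ω x₀ r D *ᵥ fun _ => (1 : ℝ))

/-- The concentration condition `P(ζ_n ≥ φ N_n) ≤ C exp(-c n ^ τ)` for some `c, C, τ > 0`, where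
the `n`-th data set is used with the radius `r n` and `⌊β / 2⌋` (strict floor) columns. -/
def ZetaConcentration {d : ℕ} (Q : Measure (Cov d × ℝ)) (β φ : ℝ) (x₀ : Cov d) (r : ℕ → ℝ) :
    Prop :=
  ∃ c C τ : ℝ, 0 < c ∧ 0 < C ∧ 0 < τ ∧ ∀ n : ℕ, 0 < n →
    (dataLaw Q n).real
        {D | φ * numInBall x₀ (r n) D ≤ zeta (strictFloor (β / 2)) x₀ (r n) D} ≤
      C * Real.exp (-c * (n : ℝ) ^ τ)

/-- The regression functions `f(r) = θ_0 + ∑_{c=1}^ω θ_c r^{2c}`. -/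
def evenPoly (ω : ℕ) : Set (ℝ → ℝ) :=
  {f | ∃ θ : ℕ → ℝ, ∀ r, f r = θ 0 + ∑ c ∈ Finset.Icc 1 ω, θ c * r ^ (2 * c)}

/-- The weight function `w_n`: `1 / N_n` up to the radius `r`, and `0` beyond it. -/
def weight {d n : ℕ} (x₀ : Cov d) (r : ℝ) (D : Data d n) (s : ℝ) : ℝ :=
  if s ≤ r then 1 / (numInBall x₀ r D : ℝ) else 0

/-- The weighted squared loss `∑ i, w_n(r_i) (Y_i - f(r_i))²`. -/
def loss {d n : ℕ} (x₀ : Cov d) (r : ℝ) (D : Data d n) (f : ℝ → ℝ) : ℝ :=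
  ∑ i, weight x₀ r D (radial x₀ D i) * ((D i).2 - f (radial x₀ D i)) ^ 2

/-- `f` minimizes the weighted squared loss over `evenPoly ω`. -/
def IsFit {d n : ℕ} (ω : ℕ) (x₀ : Cov d) (r : ℝ) (D : Data d n) (f : ℝ → ℝ) : Prop :=
  f ∈ evenPoly ω ∧ ∀ g ∈ evenPoly ω, loss x₀ r D f ≤ loss x₀ r D g

/-- A least-squares fit always exists. -/
lemma exists_isFit {d n : ℕ} (ω : ℕ) (x₀ : Cov d) (r : ℝ) (D : Data d n) :
    ∃ f, IsFit ω x₀ r D f := by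
  have hw : ∀ i, 0 ≤ weight x₀ r D (radial x₀ D i) := fun i => by
    unfold weight
    split_ifs <;> positivity
  let F : Submodule ℝ (ℝ → ℝ) :=
    { carrier := {f | ∃ θ : Fin (ω + 1) → ℝ, ∀ s, f s = ∑ c, θ c * s ^ (2 * (c : ℕ))}
      zero_mem' := ⟨0, fun s => by simp⟩
      add_mem' := by
        rintro f g ⟨θ, hf⟩ ⟨θ', hg⟩
        exact ⟨θ + θ', fun s => by simp [hf, hg, add_mul, Finset.sum_add_distrib]⟩
      smul_mem' := by
        rintro a f ⟨θ, hf⟩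
        exact ⟨a • θ, fun s => by simp [hf, mul_assoc, Finset.mul_sum]⟩ }
  have hF : ∀ f, f ∈ F ↔ f ∈ evenPoly ω := by
    have key : ∀ (θ : ℕ → ℝ) (s : ℝ), θ 0 + ∑ c ∈ Finset.Icc 1 ω, θ c * s ^ (2 * c) =
        ∑ c : Fin (ω + 1), θ c * s ^ (2 * (c : ℕ)) := by
      intro θ s
      rw [Fin.sum_univ_eq_sum_range (fun c => θ c * s ^ (2 * c)), Finset.sum_range_succ',
        add_comm, Finset.range_eq_Ico, Finset.sum_Ico_add' (fun c => θ c * s ^ (2 * c))]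
      simp only [mul_zero, pow_zero, mul_one]
      rfl
    intro f
    constructor
    · rintro ⟨θ, h⟩
      refine ⟨fun c => if h : c < ω + 1 then θ ⟨c, h⟩ else 0, fun s => ?_⟩
      refine ((h s).trans ?_).trans
        (key (fun c => if h : c < ω + 1 then θ ⟨c, h⟩ else 0) s).symm
      exact Finset.sum_congr rfl fun c _ => by rw [dif_pos c.isLt]
    · rintro ⟨θ, h⟩
      exact ⟨fun c => θ c, fun s => by rw [h, key]⟩
  let T : (ℝ → ℝ) →ₗ[ℝ] EuclideanSpace ℝ (Fin n) :=
    { toFun := fun f => WithLp.toLp 2 fun i =>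
        √(weight x₀ r D (radial x₀ D i)) * f (radial x₀ D i)
      map_add' := fun f g => by ext i; simp [mul_add]
      map_smul' := fun a f => by ext i; simp; ring }
  let y : EuclideanSpace ℝ (Fin n) := WithLp.toLp 2 fun i =>
    √(weight x₀ r D (radial x₀ D i)) * (D i).2
  have hT : ∀ f, loss x₀ r D f = ‖y - T f‖ ^ 2 := fun f => by
    rw [EuclideanSpace.norm_sq_eq]
    refine Finset.sum_congr rfl fun i _ => ?_
    simp only [y, T, LinearMap.coe_mk, AddHom.coe_mk, PiLp.sub_apply, Real.norm_eq_abs, sq_abs]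
    rw [← mul_sub, mul_pow, Real.sq_sqrt (hw i)]
  obtain ⟨v, hv, hmin⟩ := (F.map T).exists_norm_eq_iInf_of_complete_subspace
    (Submodule.complete_of_finiteDimensional _) y
  obtain ⟨f, hf, rfl⟩ := hv
  refine ⟨f, (hF f).1 hf, fun g hg => ?_⟩
  rw [hT, hT, hmin]
  have hg' : T g ∈ F.map T := ⟨g, (hF g).2 hg, rfl⟩
  refine pow_le_pow_left₀ (Real.iInf_nonneg fun _ => norm_nonneg _) ?_ 2
  exact ciInf_le ⟨0, by rintro _ ⟨_, rfl⟩; exact norm_nonneg _⟩ (⟨T g, hg'⟩ : F.map T)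

/-- The event `E_n`: `N_n ≥ 1 + ω` and `ζ_n ≤ φ N_n`. -/
def GoodEvent {d n : ℕ} (ω : ℕ) (φ : ℝ) (x₀ : Cov d) (r : ℝ) (D : Data d n) : Prop :=
  1 + ω ≤ numInBall x₀ r D ∧ zeta ω x₀ r D ≤ φ * numInBall x₀ r D

open scoped Classical in
/-- The local radial regression estimator at `x₀`: the value at `0` of a least-squares fit on the
event `E_n`, and `0` off it. -/
def lrr {d n : ℕ} (ω : ℕ) (φ : ℝ) (x₀ : Cov d) (r : ℝ) (D : Data d n) : ℝ :=
  if GoodEvent ω φ x₀ r D then Classical.epsilon (IsFit ω x₀ r D) 0 else 0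

/-- The radius `n ^ (-1 / (d + 2 β))`. -/
def optRadius (d : ℕ) (β : ℝ) (n : ℕ) : ℝ := (n : ℝ) ^ (-1 / ((d : ℝ) + 2 * β))

end LocalRadial

end

/-! Where the Gram matrix of the radial design is nonsingular, the fit at `0` is a linear smoother
`∑ w_i Y_i`. Its weights are the residual of the all-one vector after projection onto the columns `r
^ 2, …, r ^ (2ω)`, divided by `N - ζ`. They vanish outside the ball and depend on the radii only.
They reproduce the value at `0` of every even polynomial of degree at most `2ω`
(`sum_lrrWeight_mul_even`), and on the good event `∑ w_i ^ 2 = 1 / (N - ζ) ≤ 1 / ((1 - φ) N)`.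

Hence only the regression of the label on the distance, `m(s) = P(Y = 1 | ‖X - x₀‖ = s)`, matters.
Heuristically `m(s)` is the ratio of the averages of `η μ` and `μ` over the sphere of radius `s`.
Averaging kills odd monomials and turns even ones into powers of `s ^ 2`, and `μ x₀ ≠ 0` allows
division. So `m(s) = p(s ^ 2) + O(s ^ β)` with `deg p ≤ ω` and `p(0) = η x₀`, because `β ≤ 2(ω +
1)`. This is proved in integrated form, over sets of radii, by `exists_radial_expansion` and
`ae_abs_radial_prob_sub_le`.

The squared bias is then `O(r ^ (2β))` by Cauchy-Schwarz. The variance is at most a multiple of `E[1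
/ (1 + N)] ≤ 1 / (n p_r)`, where the ball probability `p_r` is at least of order `r ^ d`. Off the
good event the error is `(η x₀) ^ 2`; too few points are again paid for by `1 / (1 + N)`, a large
`ζ` by the concentration hypothesis. The radius satisfies `n r ^ d = r ^ (-2β)`, so all terms have
the claimed order. -/

noncomputable section

namespace LocalRadial

/-! ### The projection and the smoothing weights as functions of the radii -/

/-- The indicator of `s ≤ r`. -/
def ballInd (r s : ℝ) : ℝ := if s ≤ r then 1 else 0

/-- The number of radii that are at most `r`. -/
def count {n : ℕ} (r : ℝ) (ρ : Fin n → ℝ) : ℝ := ∑ i, ballInd r (ρ i)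

/-- The inner products of the all-one vector with the columns of the radial design. -/
def moment {n : ℕ} (ω : ℕ) (r : ℝ) (ρ : Fin n → ℝ) : Fin ω → ℝ := fun a =>
  ∑ i, ballInd r (ρ i) * ρ i ^ (2 * ((a : ℕ) + 1))

/-- The Gram matrix of the radial design. -/
def gram {n : ℕ} (ω : ℕ) (r : ℝ) (ρ : Fin n → ℝ) : Matrix (Fin ω) (Fin ω) ℝ :=
  Matrix.of fun a b =>
    ∑ i, ballInd r (ρ i) * (ρ i ^ (2 * ((a : ℕ) + 1)) * ρ i ^ (2 * ((b : ℕ) + 1)))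

/-- The coefficients of the projection of the all-one vector onto the radial design. -/
def coef {n : ℕ} (ω : ℕ) (r : ℝ) (ρ : Fin n → ℝ) : Fin ω → ℝ :=
  (gram ω r ρ)⁻¹ *ᵥ moment ω r ρ

/-- The squared length of the projection of the all-one vector onto the radial design. -/
def projOne {n : ℕ} (ω : ℕ) (r : ℝ) (ρ : Fin n → ℝ) : ℝ := moment ω r ρ ⬝ᵥ coef ω r ρ

/-- The residual of the all-one vector after projection onto the radial design. -/
def resid {n : ℕ} (ω : ℕ) (r : ℝ) (ρ : Fin n → ℝ) (s : ℝ) : ℝ :=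
  1 - ∑ a : Fin ω, coef ω r ρ a * s ^ (2 * ((a : ℕ) + 1))

/-- The good event, as a condition on the radii, with a nonsingular Gram matrix. -/
def Regular {n : ℕ} (ω : ℕ) (φ r : ℝ) (ρ : Fin n → ℝ) : Prop :=
  (gram ω r ρ).det ≠ 0 ∧ 1 + (ω : ℝ) ≤ count r ρ ∧ projOne ω r ρ ≤ φ * count r ρ

open scoped Classical in
/-- The weights of the local radial regression estimator as a linear smoother. -/
def lrrWeight {n : ℕ} (ω : ℕ) (φ r : ℝ) (ρ : Fin n → ℝ) (i : Fin n) : ℝ :=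
  if Regular ω φ r ρ then
    ballInd r (ρ i) * resid ω r ρ (ρ i) / (count r ρ - projOne ω r ρ) else 0

lemma ballInd_nonneg (r s : ℝ) : 0 ≤ ballInd r s := by
  unfold ballInd; split_ifs <;> norm_num

lemma ballInd_le_one (r s : ℝ) : ballInd r s ≤ 1 := by
  unfold ballInd; split_ifs <;> norm_num

lemma ballInd_mul_self (r s : ℝ) : ballInd r s * ballInd r s = ballInd r s := by
  unfold ballInd; split_ifs <;> norm_num

lemma measurable_ballInd (r : ℝ) : Measurable (ballInd r) :=
  Measurable.ite measurableSet_Iic measurable_const measurable_const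

/-! ### Exactness and size of the weights -/

section Algebra

variable {n : ℕ} (ω : ℕ) (r : ℝ) (ρ : Fin n → ℝ)

lemma gram_mulVec_coef (h : (gram ω r ρ).det ≠ 0) :
    gram ω r ρ *ᵥ coef ω r ρ = moment ω r ρ := by
  unfold coef
  rw [Matrix.mulVec_mulVec, Matrix.mul_nonsing_inv _ (isUnit_iff_ne_zero.mpr h),
    Matrix.one_mulVec]

/-- The normal equations for `coef`: the residual is orthogonal to every column of the design. -/
lemma sum_ballInd_mul_resid_mul_pow (h : (gram ω r ρ).det ≠ 0) (a : Fin ω) :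
    ∑ i, ballInd r (ρ i) * resid ω r ρ (ρ i) * ρ i ^ (2 * ((a : ℕ) + 1)) = 0 := by
  have h1 := congrFun (gram_mulVec_coef ω r ρ h) a
  simp only [Matrix.mulVec, dotProduct, gram, Matrix.of_apply, moment] at h1
  have h2 : ∀ i, ballInd r (ρ i) * resid ω r ρ (ρ i) * ρ i ^ (2 * ((a : ℕ) + 1)) =
      ballInd r (ρ i) * ρ i ^ (2 * ((a : ℕ) + 1)) -
      ∑ b : Fin ω, ballInd r (ρ i) *
        (ρ i ^ (2 * ((a : ℕ) + 1)) * ρ i ^ (2 * ((b : ℕ) + 1))) * coef ω r ρ b := by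
    intro i
    rw [resid, mul_sub, sub_mul, mul_one, Finset.mul_sum, Finset.sum_mul]
    congr 1
    exact Finset.sum_congr rfl fun b _ => by ring
  simp_rw [h2]
  rw [Finset.sum_sub_distrib, Finset.sum_comm, ← h1, sub_eq_zero]
  exact Finset.sum_congr rfl fun b _ => by rw [Finset.sum_mul]

lemma sum_ballInd_mul_resid :
    ∑ i, ballInd r (ρ i) * resid ω r ρ (ρ i) = count r ρ - projOne ω r ρ := by
  unfold resid
  simp_rw [mul_sub, mul_one, Finset.mul_sum]
  rw [Finset.sum_sub_distrib, Finset.sum_comm]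
  congr 1
  unfold projOne dotProduct moment
  refine Finset.sum_congr rfl fun a _ => ?_
  rw [Finset.sum_mul]
  exact Finset.sum_congr rfl fun i _ => by ring

lemma sum_ballInd_mul_resid_mul_even (h : (gram ω r ρ).det ≠ 0) (t : ℝ) (θ : Fin ω → ℝ) :
    ∑ i, ballInd r (ρ i) * resid ω r ρ (ρ i) *
      (t + ∑ a, θ a * ρ i ^ (2 * ((a : ℕ) + 1))) = t * (count r ρ - projOne ω r ρ) := by
  simp_rw [mul_add, Finset.mul_sum]
  rw [Finset.sum_add_distrib, ← Finset.sum_mul, sum_ballInd_mul_resid, Finset.sum_comm,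
    Finset.sum_eq_zero, add_zero, mul_comm]
  intro a _
  rw [← mul_zero (θ a), ← sum_ballInd_mul_resid_mul_pow ω r ρ h a, Finset.mul_sum]
  exact Finset.sum_congr rfl fun i _ => by ring

/-- Pythagoras: the residual differs from the all-one vector by a combination of columns, to which
it is orthogonal. -/
lemma sum_ballInd_mul_resid_sq (h : (gram ω r ρ).det ≠ 0) :
    ∑ i, ballInd r (ρ i) * resid ω r ρ (ρ i) ^ 2 = count r ρ - projOne ω r ρ := by
  rw [← one_mul (count r ρ - projOne ω r ρ),
    ← sum_ballInd_mul_resid_mul_even ω r ρ h 1 (fun a => -coef ω r ρ a)]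
  refine Finset.sum_congr rfl fun i _ => ?_
  simp only [neg_mul, Finset.sum_neg_distrib, ← sub_eq_add_neg]
  rw [sq, ← mul_assoc]
  rfl

/-- Because of this exactness, only the non-polynomial part of the radial regression function
contributes to the bias. -/
lemma sum_lrrWeight_mul_even {φ : ℝ} (hφ : φ < 1) (h : Regular ω φ r ρ) (t : ℝ)
    (θ : Fin ω → ℝ) :
    ∑ i, lrrWeight ω φ r ρ i * (t + ∑ a, θ a * ρ i ^ (2 * ((a : ℕ) + 1))) = t := by
  have hpos : 0 < count r ρ - projOne ω r ρ := by
    have h1 : 0 < count r ρ := lt_of_lt_of_le (by positivity) h.2.1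
    nlinarith [h.2.2]
  simp only [lrrWeight, if_pos h, div_mul_eq_mul_div]
  rw [← Finset.sum_div, sum_ballInd_mul_resid_mul_even ω r ρ h.1, mul_div_cancel_right₀ _ hpos.ne']

lemma lrrWeight_of_not {φ : ℝ} (h : ¬ Regular ω φ r ρ) (i : Fin n) :
    lrrWeight ω φ r ρ i = 0 := if_neg h

lemma lrrWeight_of_lt {φ : ℝ} (i : Fin n) (h : r < ρ i) : lrrWeight ω φ r ρ i = 0 := by
  unfold lrrWeight ballInd
  rw [if_neg h.not_ge]
  simp

lemma count_nonneg : 0 ≤ count r ρ := Finset.sum_nonneg fun _ _ => ballInd_nonneg _ _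

lemma count_mul_sum_lrrWeight_sq_le {φ : ℝ} (hφ : φ < 1) :
    count r ρ * ∑ i, lrrWeight ω φ r ρ i ^ 2 ≤ 1 / (1 - φ) := by
  by_cases h : Regular ω φ r ρ
  · have h1 : 0 < count r ρ := lt_of_lt_of_le (by positivity) h.2.1
    have hle : (1 - φ) * count r ρ ≤ count r ρ - projOne ω r ρ := by linarith [h.2.2]
    have hpos : 0 < count r ρ - projOne ω r ρ := lt_of_lt_of_le (by nlinarith) hle
    have h2 : ∑ i, lrrWeight ω φ r ρ i ^ 2 = 1 / (count r ρ - projOne ω r ρ) := by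
      simp only [lrrWeight, if_pos h, div_pow]
      rw [← Finset.sum_div]
      have : ∀ i, (ballInd r (ρ i) * resid ω r ρ (ρ i)) ^ 2 =
          ballInd r (ρ i) * resid ω r ρ (ρ i) ^ 2 := fun i => by
        rw [mul_pow, sq (ballInd _ _), ballInd_mul_self]
      simp_rw [this]
      rw [sum_ballInd_mul_resid_sq ω r ρ h.1]
      field_simp
    rw [h2, mul_one_div, div_le_div_iff₀ hpos (by linarith)]
    linarith
  · simp only [lrrWeight_of_not ω r ρ h]
    have : 0 < 1 - φ := by linarith
    simp [this.le]

/-- The factor `2` pays for replacing `1 / N` by `1 / (1 + N)`, since `N ≥ 1` whenever the weights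
are nonzero. The latter form makes sense at `N = 0` and has a simple expectation bound. -/
lemma sum_lrrWeight_sq_le {φ : ℝ} (hφ : φ < 1) :
    ∑ i, lrrWeight ω φ r ρ i ^ 2 ≤ 2 / (1 - φ) * (1 / (1 + count r ρ)) := by
  have hφ' : 0 < 1 - φ := by linarith
  by_cases h : Regular ω φ r ρ
  · have h1 : 1 ≤ count r ρ := le_trans (by simp) h.2.1
    have h2 := count_mul_sum_lrrWeight_sq_le ω r ρ hφ
    have h3 : 0 ≤ ∑ i, lrrWeight ω φ r ρ i ^ 2 := Finset.sum_nonneg fun i _ => sq_nonneg _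
    rw [mul_one_div, le_div_iff₀ (by linarith)]
    have : 2 / (1 - φ) = 2 * (1 / (1 - φ)) := by ring
    rw [this]
    nlinarith
  · simp only [lrrWeight_of_not ω r ρ h]
    have := count_nonneg r ρ
    simp only [ne_eq, OfNat.ofNat_ne_zero, not_false_eq_true, zero_pow, Finset.sum_const_zero]
    positivity

/-- Cauchy-Schwarz for the weighted sums of the smoother. -/
lemma sq_sum_lrrWeight_mul_le {φ : ℝ} (hφ : φ < 1) (ε : Fin n → ℝ) {K : ℝ}
    (hε : ∀ i, ρ i ≤ r → |ε i| ≤ K) :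
    (∑ i, lrrWeight ω φ r ρ i * ε i) ^ 2 ≤ K ^ 2 / (1 - φ) := by
  have h1 : ∀ i, lrrWeight ω φ r ρ i * ε i =
      lrrWeight ω φ r ρ i * (ballInd r (ρ i) * ε i) := by
    intro i
    by_cases h : ρ i ≤ r
    · simp [ballInd, h]
    · simp [lrrWeight_of_lt ω r ρ i (not_le.mp h)]
  simp_rw [h1]
  have h2 : ∑ i, (ballInd r (ρ i) * ε i) ^ 2 ≤ K ^ 2 * count r ρ := by
    rw [count, Finset.mul_sum]
    refine Finset.sum_le_sum fun i _ => ?_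
    by_cases h : ρ i ≤ r
    · simp only [ballInd, h, if_true, one_mul, mul_one]
      exact sq_le_sq.mpr ((hε i h).trans (le_abs_self K))
    · simp [ballInd, h]
  have h3 : 0 ≤ ∑ i, lrrWeight ω φ r ρ i ^ 2 := Finset.sum_nonneg fun i _ => sq_nonneg _
  calc _ ≤ (∑ i, lrrWeight ω φ r ρ i ^ 2) * ∑ i, (ballInd r (ρ i) * ε i) ^ 2 :=
        Finset.sum_mul_sq_le_sq_mul_sq _ _ _
    _ ≤ (∑ i, lrrWeight ω φ r ρ i ^ 2) * (K ^ 2 * count r ρ) := by gcongr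
    _ = K ^ 2 * (count r ρ * ∑ i, lrrWeight ω φ r ρ i ^ 2) := by ring
    _ ≤ K ^ 2 * (1 / (1 - φ)) := by
        gcongr; exact count_mul_sum_lrrWeight_sq_le ω r ρ hφ
    _ = _ := by ring

lemma abs_lrrWeight_le {φ : ℝ} (hφ : φ ∈ Set.Ioo (0 : ℝ) 1) (i : Fin n) :
    |lrrWeight ω φ r ρ i| ≤ 2 / (1 - φ) := by
  have hφ' : 0 < 1 - φ := by linarith [hφ.2]
  have h1 : lrrWeight ω φ r ρ i ^ 2 ≤ 2 / (1 - φ) := by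
    refine (Finset.single_le_sum (f := fun i => lrrWeight ω φ r ρ i ^ 2)
      (fun i _ => sq_nonneg _) (Finset.mem_univ i)).trans
      ((sum_lrrWeight_sq_le ω r ρ hφ.2).trans ?_)
    refine mul_le_of_le_one_right (by positivity) ?_
    rw [div_le_one (by linarith [count_nonneg r ρ])]
    linarith [count_nonneg r ρ]
  have h2 : 1 ≤ 2 / (1 - φ) := by rw [le_div_iff₀ hφ']; linarith [hφ.1]
  refine abs_le_of_sq_le_sq (h1.trans ?_) (by linarith)
  nlinarith

/-- The Gram matrix is nonsingular if enough nonzero radii are distinct. -/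
lemma det_gram_ne_zero (hinj : Function.Injective ρ) (hpos : ∀ i, 0 < ρ i)
    (hc : (ω : ℝ) ≤ count r ρ) : (gram ω r ρ).det ≠ 0 := by
  intro h0
  obtain ⟨v, hv0, hv⟩ := Matrix.exists_mulVec_eq_zero_iff.mpr h0
  -- The quadratic form of the Gram matrix at a kernel vector is a sum of squares, so each of them
  -- vanishes.
  have h1 : ∑ i, ballInd r (ρ i) * (∑ a, v a * ρ i ^ (2 * ((a : ℕ) + 1))) ^ 2 = 0 := by
    have : v ⬝ᵥ (gram ω r ρ *ᵥ v) = 0 := by rw [hv, dotProduct_zero]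
    rw [← this]
    simp only [Matrix.mulVec, dotProduct, gram, Matrix.of_apply, Finset.mul_sum, Finset.sum_mul,
      sq]
    rw [Finset.sum_comm]
    refine Finset.sum_congr rfl fun a _ => ?_
    rw [Finset.sum_comm]
    exact Finset.sum_congr rfl fun b _ => Finset.sum_congr rfl fun i _ => by ring
  rw [Finset.sum_eq_zero_iff_of_nonneg
    fun i _ => mul_nonneg (ballInd_nonneg _ _) (sq_nonneg _)] at h1
  -- The even polynomial with coefficients `v` equals `s ^ 2 * P(s ^ 2)`. So `P`, of degree below
  -- `ω`, vanishes at the squares of the radii in the ball, which are at least `ω` distinct numbers.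
  let P : Polynomial ℝ := ∑ a : Fin ω, Polynomial.C (v a) * Polynomial.X ^ (a : ℕ)
  have hP : P = 0 := by
    have hdeg : P.degree < ω := by
      refine (Polynomial.degree_sum_le _ _).trans_lt ?_
      refine (Finset.sup_lt_iff (WithBot.bot_lt_coe ω)).mpr fun a _ => ?_
      exact (Polynomial.degree_C_mul_X_pow_le _ _).trans_lt (WithBot.coe_lt_coe.mpr a.isLt)
    let s := (Finset.univ.filter fun i => ρ i ≤ r).image fun i => ρ i ^ 2
    have hs : ω ≤ s.card := by
      rw [Finset.card_image_of_injective]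
      · have : count r ρ = ((Finset.univ.filter fun i => ρ i ≤ r).card : ℝ) := by
          simp [count, ballInd]
        rw [this] at hc
        exact_mod_cast hc
      · intro i j hij
        exact hinj ((sq_eq_sq₀ (hpos i).le (hpos j).le).mp hij)
    refine Polynomial.eq_zero_of_degree_lt_of_eval_finset_eq_zero s
      (hdeg.trans_le (by exact_mod_cast hs)) ?_
    intro x hx
    obtain ⟨i, hi, rfl⟩ := Finset.mem_image.mp hx
    have h2 := h1 i (Finset.mem_univ i)
    rw [ballInd, if_pos (Finset.mem_filter.mp hi).2, one_mul, sq_eq_zero_iff] at h2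
    have h3 : ρ i ^ 2 * P.eval (ρ i ^ 2) = 0 := by
      rw [← h2, Polynomial.eval_finsetSum, Finset.mul_sum]
      refine Finset.sum_congr rfl fun a _ => ?_
      simp only [Polynomial.eval_mul, Polynomial.eval_C, Polynomial.eval_pow, Polynomial.eval_X]
      ring
    exact (mul_eq_zero.mp h3).resolve_left (pow_pos (hpos i) 2).ne'
  apply hv0
  funext a
  have := congrArg (fun p => Polynomial.coeff p (a : ℕ)) hP
  simpa [P, Polynomial.finsetSum_coeff, Polynomial.coeff_X_pow, Fin.ext_iff.symm] using this

end Algebra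

/-! ### Measurability of the weights -/

section Measurability

variable {n : ℕ} (ω : ℕ) (r : ℝ)

lemma measurable_count : Measurable (count r : (Fin n → ℝ) → ℝ) :=
  Finset.measurable_fun_sum _ fun i _ => (measurable_ballInd r).comp (measurable_pi_apply i)

lemma measurable_moment (a : Fin ω) : Measurable fun ρ : Fin n → ℝ => moment ω r ρ a :=
  Finset.measurable_fun_sum _ fun i _ =>
    ((measurable_ballInd r).comp (measurable_pi_apply i)).mul ((measurable_pi_apply i).pow_const _)

lemma measurable_gram (a b : Fin ω) : Measurable fun ρ : Fin n → ℝ => gram ω r ρ a b := by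
  simp only [gram, Matrix.of_apply]
  exact Finset.measurable_fun_sum _ fun i _ =>
    Measurable.fun_mul ((measurable_ballInd r).comp (measurable_pi_apply i))
      (Measurable.fun_mul ((measurable_pi_apply i).pow_const _)
        ((measurable_pi_apply i).pow_const _))

lemma measurable_det {α ι : Type*} [MeasurableSpace α] [Fintype ι] [DecidableEq ι]
    {A : α → Matrix ι ι ℝ} (hA : ∀ a b, Measurable fun x => A x a b) :
    Measurable fun x => (A x).det := by
  simp_rw [Matrix.det_apply]
  refine Finset.measurable_fun_sum _ fun σ _ => ?_
  exact (Finset.measurable_fun_prod _ fun i _ => hA _ _).const_smul _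

lemma measurable_coef (a : Fin ω) : Measurable fun ρ : Fin n → ℝ => coef ω r ρ a := by
  unfold coef Matrix.mulVec dotProduct
  refine Finset.measurable_fun_sum _ fun b _ => ?_
  refine Measurable.mul ?_ (measurable_moment ω r b)
  -- Cramer's rule: entries of the inverse are determinants over a determinant. With division by
  -- zero equal to zero this also covers singular matrices.
  simp only [Matrix.inv_def, Matrix.smul_apply, Ring.inverse_eq_inv', smul_eq_mul,
    Matrix.adjugate_apply]
  refine (measurable_det fun a b => measurable_gram ω r a b).inv.mul (measurable_det ?_)
  intro c e
  by_cases hc : c = b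
  · subst hc; simp
  · simpa [Matrix.updateRow_ne hc] using measurable_gram ω r c e

lemma measurable_projOne : Measurable (projOne ω r : (Fin n → ℝ) → ℝ) := by
  unfold projOne dotProduct
  exact Finset.measurable_fun_sum _ fun a _ =>
    (measurable_moment ω r a).fun_mul (measurable_coef ω r a)

lemma measurableSet_regular (φ : ℝ) : MeasurableSet {ρ : Fin n → ℝ | Regular ω φ r ρ} := by
  refine ((measurable_det fun a b => measurable_gram ω r a b)
    (measurableSet_singleton (0 : ℝ)).compl).inter
    ((measurableSet_le measurable_const (measurable_count r)).inter
      (measurableSet_le (measurable_projOne ω r) ((measurable_count r).const_mul φ)))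

lemma measurable_lrrWeight (φ : ℝ) (i : Fin n) :
    Measurable fun ρ : Fin n → ℝ => lrrWeight ω φ r ρ i := by
  classical
  unfold lrrWeight
  refine Measurable.ite (measurableSet_regular ω r φ) ?_ measurable_const
  refine Measurable.div (Measurable.mul ((measurable_ballInd r).comp (measurable_pi_apply i)) ?_)
    ((measurable_count r).sub (measurable_projOne ω r))
  unfold resid
  exact measurable_const.sub (Finset.measurable_fun_sum _ fun a _ =>
    (measurable_coef ω r a).mul ((measurable_pi_apply i).pow_const _))

end Measurability

/-! ### The least-squares estimator as a linear smoother -/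

section Estimator

variable {d n : ℕ} (ω : ℕ) (x₀ : Cov d) (r : ℝ) (D : Data d n)

lemma numInBall_eq_count : (numInBall x₀ r D : ℝ) = count r (radial x₀ D) := by
  simp [numInBall, inBall, count, ballInd]

lemma sum_inBall (F : Fin n → ℝ) :
    ∑ i : inBall x₀ r D, F i = ∑ i, ballInd r (radial x₀ D i) * F i := by
  rw [Finset.sum_coe_sort (inBall x₀ r D) F, inBall, Finset.sum_filter]
  exact Finset.sum_congr rfl fun i _ => by simp [ballInd]

/-- Sums over the random index set of the ball become indicator-weighted sums over all observations,
so that everything is a function of the vector of radii. -/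
lemma zeta_eq_projOne : zeta ω x₀ r D = projOne ω r (radial x₀ D) := by
  have hG : (radialMatrix ω x₀ r D)ᵀ * radialMatrix ω x₀ r D = gram ω r (radial x₀ D) := by
    ext a b
    simp only [Matrix.mul_apply, Matrix.transpose_apply, radialMatrix, gram, Matrix.of_apply]
    exact sum_inBall x₀ r D fun i =>
      radial x₀ D i ^ (2 * ((a : ℕ) + 1)) * radial x₀ D i ^ (2 * ((b : ℕ) + 1))
  have hv : (radialMatrix ω x₀ r D)ᵀ *ᵥ (fun _ => (1 : ℝ)) = moment ω r (radial x₀ D) := by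
    ext a
    simp only [Matrix.mulVec, dotProduct, Matrix.transpose_apply, radialMatrix, Matrix.of_apply,
      mul_one, moment]
    exact sum_inBall x₀ r D fun i => radial x₀ D i ^ (2 * ((a : ℕ) + 1))
  unfold zeta radialProj projOne coef
  rw [hG, ← Matrix.mulVec_mulVec, hv, ← Matrix.mulVec_mulVec, Matrix.dotProduct_mulVec,
    ← Matrix.mulVec_transpose, hv]

lemma mem_evenPoly_iff (f : ℝ → ℝ) :
    f ∈ evenPoly ω ↔
      ∃ (t : ℝ) (θ : Fin ω → ℝ), ∀ s, f s = t + ∑ a, θ a * s ^ (2 * ((a : ℕ) + 1)) := by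
  have key : ∀ (θ : ℕ → ℝ) (s : ℝ), ∑ c ∈ Finset.Icc 1 ω, θ c * s ^ (2 * c) =
      ∑ a : Fin ω, θ (a + 1) * s ^ (2 * ((a : ℕ) + 1)) := by
    intro θ s
    rw [Fin.sum_univ_eq_sum_range (fun c => θ (c + 1) * s ^ (2 * (c + 1))),
      Finset.range_eq_Ico, Finset.sum_Ico_add' (fun c => θ c * s ^ (2 * c))]
    rfl
  constructor
  · rintro ⟨θ, h⟩
    exact ⟨θ 0, fun a => θ (a + 1), fun s => by rw [h, key]⟩
  · rintro ⟨t, θ, h⟩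
    let ψ : ℕ → ℝ := fun c => if hc : c - 1 < ω then θ ⟨c - 1, hc⟩ else 0
    refine ⟨fun c => if c = 0 then t else ψ c, fun s => ?_⟩
    rw [h, key]
    simp [ψ]

/-- The normal equations of a least-squares fit. -/
lemma IsFit.normal_eq {f : ℝ → ℝ} (hf : IsFit ω x₀ r D f) (hN : 0 < count r (radial x₀ D))
    {g : ℝ → ℝ} (hg : g ∈ evenPoly ω) :
    ∑ i, ballInd r (radial x₀ D i) * g (radial x₀ D i) * ((D i).2 - f (radial x₀ D i)) = 0 := by
  set S := ∑ i, ballInd r (radial x₀ D i) * g (radial x₀ D i) * ((D i).2 - f (radial x₀ D i))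
  set T := ∑ i, ballInd r (radial x₀ D i) * g (radial x₀ D i) ^ 2 with hTdef
  have hT : 0 ≤ T := Finset.sum_nonneg fun i _ => mul_nonneg (ballInd_nonneg _ _) (sq_nonneg _)
  have hloss : ∀ h : ℝ → ℝ, count r (radial x₀ D) * loss x₀ r D h =
      ∑ i, ballInd r (radial x₀ D i) * ((D i).2 - h (radial x₀ D i)) ^ 2 := by
    intro h
    rw [loss, Finset.mul_sum]
    refine Finset.sum_congr rfl fun i _ => ?_
    rw [weight, numInBall_eq_count, ballInd]
    split_ifs
    · field_simp
    · simp
  -- Along the line `f + t g` the scaled loss changes by `t ^ 2 T - 2 t S`, which is nonnegative for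
  -- every `t` by minimality; this forces `S = 0`.
  have hquad : ∀ t : ℝ, 0 ≤ t ^ 2 * T - 2 * t * S := by
    intro t
    have hmem : (fun s => f s + t * g s) ∈ evenPoly ω := by
      obtain ⟨θ, hθ⟩ := hf.1
      obtain ⟨ψ, hψ⟩ := hg
      refine ⟨fun c => θ c + t * ψ c, fun s => ?_⟩
      dsimp only
      rw [hθ, hψ, mul_add, Finset.mul_sum]
      simp_rw [add_mul]
      rw [Finset.sum_add_distrib]
      simp_rw [mul_assoc]
      ring
    have h1 := mul_le_mul_of_nonneg_left (hf.2 _ hmem) hN.le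
    rw [hloss, hloss] at h1
    have h2 : ∑ i, ballInd r (radial x₀ D i) *
        ((D i).2 - (f (radial x₀ D i) + t * g (radial x₀ D i))) ^ 2 =
        ∑ i, ballInd r (radial x₀ D i) * ((D i).2 - f (radial x₀ D i)) ^ 2 +
          (t ^ 2 * T - 2 * t * S) := by
      simp only [S, T, Finset.mul_sum, ← Finset.sum_sub_distrib, ← Finset.sum_add_distrib]
      exact Finset.sum_congr rfl fun i _ => by ring
    linarith
  by_contra hS
  -- The vertex would be `S / T`; the `+ 1` avoids the case `T = 0` and still gives a negative value
  -- when `S ≠ 0`.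
  have h3 := hquad (S / (T + 1))
  have h4 : (S / (T + 1)) ^ 2 * T - 2 * (S / (T + 1)) * S =
      -(S ^ 2 * (T + 2) / (T + 1) ^ 2) := by
    field_simp
    ring
  have h5 : 0 < S ^ 2 * (T + 2) / (T + 1) ^ 2 := by positivity
  linarith

lemma goodEvent_iff (φ : ℝ) : GoodEvent ω φ x₀ r D ↔
    1 + (ω : ℝ) ≤ count r (radial x₀ D) ∧
      projOne ω r (radial x₀ D) ≤ φ * count r (radial x₀ D) := by
  rw [GoodEvent, zeta_eq_projOne, numInBall_eq_count, ← numInBall_eq_count]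
  norm_cast

/-- The local radial regression estimator is a linear smoother. -/
lemma lrr_eq_sum {φ : ℝ} (hφ : φ < 1)
    (hdet : (ω : ℝ) ≤ count r (radial x₀ D) → (gram ω r (radial x₀ D)).det ≠ 0) :
    lrr ω φ x₀ r D = ∑ i, lrrWeight ω φ r (radial x₀ D) i * (D i).2 := by
  by_cases h : GoodEvent ω φ x₀ r D
  · rw [lrr, if_pos h]
    have hfit : IsFit ω x₀ r D (Classical.epsilon (IsFit ω x₀ r D)) :=
      Classical.epsilon_spec (exists_isFit ω x₀ r D)
    generalize Classical.epsilon (IsFit ω x₀ r D) = f at hfit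
    rw [goodEvent_iff] at h
    have hreg : Regular ω φ r (radial x₀ D) := ⟨hdet (by linarith [h.1]), h⟩
    obtain ⟨t, θ, hθ⟩ := (mem_evenPoly_iff ω f).mp hfit.1
    have hf0 : f 0 = t := by simp [hθ]
    have h1 := sum_lrrWeight_mul_even ω r (radial x₀ D) hφ hreg t θ
    rw [hf0, ← h1]
    -- By exactness `f 0` is the weighted sum of the fitted values. The normal equation tested with
    -- the residual function replaces these by the labels. Any minimizer will do, so uniqueness of
    -- the fit plays no role.
    have hg : resid ω r (radial x₀ D) ∈ evenPoly ω :=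
      (mem_evenPoly_iff ω _).mpr ⟨1, fun a => -coef ω r (radial x₀ D) a, fun s => by
        simp [resid, sub_eq_add_neg]⟩
    have h2 := hfit.normal_eq ω x₀ r D (lt_of_lt_of_le (by positivity) h.1) hg
    rw [← sub_eq_zero, ← neg_eq_zero, neg_sub, ← Finset.sum_sub_distrib]
    simp_rw [← hθ, ← mul_sub, lrrWeight, if_pos hreg, div_mul_eq_mul_div]
    rw [← Finset.sum_div, h2, zero_div]
  · rw [lrr, if_neg h]
    rw [goodEvent_iff] at h
    simp [lrrWeight_of_not ω r (radial x₀ D) fun hr : Regular ω φ r _ => h hr.2]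

end Estimator

/-! ### Independence by resampling one observation -/

section Resampling

variable {Ω : Type*} [MeasurableSpace Ω] (Q : Measure Ω) [IsProbabilityMeasure Q] {n : ℕ}

/-- Resampling one coordinate of an i.i.d. sample does not change its law. -/
lemma measurePreserving_update_pi (i : Fin n) :
    MeasurePreserving (fun p : (Fin n → Ω) × Ω => Function.update p.1 i p.2)
      ((Measure.pi fun _ : Fin n => Q).prod Q) (Measure.pi fun _ : Fin n => Q) := by
  refine ⟨measurable_update', (Measure.pi_eq fun s hs => ?_).symm⟩
  rw [Measure.map_apply measurable_update' (MeasurableSet.univ_pi hs)]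
  have : (fun p : (Fin n → Ω) × Ω => Function.update p.1 i p.2) ⁻¹' Set.univ.pi s =
      (Set.univ.pi (Function.update s i Set.univ)) ×ˢ s i := by
    ext ⟨D, z⟩
    simp only [Set.mem_preimage, Set.mem_pi, Set.mem_univ, forall_const, Set.mem_prod]
    constructor
    · intro h
      refine ⟨fun j => ?_, by simpa using h i⟩
      by_cases hj : j = i
      · subst hj; simp
      · simpa [hj] using h j
    · rintro ⟨h, hz⟩ j
      by_cases hj : j = i
      · subst hj; simpa using hz
      · simpa [hj] using h j
  rw [this, Measure.prod_prod, Measure.pi_pi, ← Finset.mul_prod_erase _ _ (Finset.mem_univ i),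
    ← Finset.mul_prod_erase Finset.univ (fun j => Q (s j)) (Finset.mem_univ i)]
  simp only [Function.update_self, measure_univ, one_mul]
  rw [mul_comm]
  congr 1
  refine Finset.prod_congr rfl fun j hj => ?_
  rw [Function.update_of_ne (Finset.ne_of_mem_erase hj)]

lemma integral_pi_eq_integral_update (i : Fin n) {F : (Fin n → Ω) → ℝ}
    (hF : Integrable F (Measure.pi fun _ : Fin n => Q)) :
    ∫ D, F D ∂(Measure.pi fun _ : Fin n => Q) =
      ∫ D, ∫ z, F (Function.update D i z) ∂Q ∂(Measure.pi fun _ : Fin n => Q) := by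
  have h := measurePreserving_update_pi Q i
  have hF' : AEStronglyMeasurable F
      (((Measure.pi fun _ : Fin n => Q).prod Q).map
        fun p : (Fin n → Ω) × Ω => Function.update p.1 i p.2) := by
    rw [h.map_eq]; exact hF.1
  have h1 := integral_map h.measurable.aemeasurable hF'
  rw [h.map_eq] at h1
  rw [h1]
  exact integral_prod _ (h.integrable_comp_of_integrable hF)

/-- Two coordinates of an i.i.d. sample almost surely do not meet under a map whose law has no
atoms. -/
lemma ae_ne_of_noAtoms {ρ₀ : Ω → ℝ} (hρ : Measurable ρ₀) (hatom : ∀ s, Q {z | ρ₀ z = s} = 0)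
    {i j : Fin n} (hij : i ≠ j) :
    ∀ᵐ D ∂(Measure.pi fun _ : Fin n => Q), ρ₀ (D i) ≠ ρ₀ (D j) := by
  have hms : MeasurableSet {D : Fin n → Ω | ρ₀ (D i) = ρ₀ (D j)} :=
    measurableSet_eq_fun (hρ.comp (measurable_pi_apply i)) (hρ.comp (measurable_pi_apply j))
  have h := measurePreserving_update_pi Q i
  rw [ae_iff]
  simp only [ne_eq, not_not]
  rw [← h.measure_preimage hms.nullMeasurableSet,
    Measure.measure_prod_null (h.measurable hms)]
  refine Filter.Eventually.of_forall fun D => ?_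
  simp only [Set.preimage_ofPred_eq, Function.update_self, Function.update_of_ne hij.symm]
  exact hatom _

lemma integrable_of_abs_le {α : Type*} [MeasurableSpace α] {P : Measure α} [IsFiniteMeasure P]
    {F : α → ℝ} (hF : Measurable F) {K : ℝ} (hK : ∀ x, |F x| ≤ K) : Integrable F P :=
  Integrable.of_bound hF.aestronglyMeasurable K (Filter.Eventually.of_forall hK)

/-- The bound `E[1 / (1 + N)] ≤ 1 / (n p)` for a binomial variable `N`. -/
lemma mul_integral_inv_one_add_count_le {ρ₀ : Ω → ℝ} (hρ : Measurable ρ₀) (r : ℝ) :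
    (n : ℝ) * Q.real {z | ρ₀ z ≤ r} *
      ∫ D, 1 / (1 + count r (fun i => ρ₀ (D i))) ∂(Measure.pi fun _ : Fin n => Q) ≤ 1 := by
  set P := Measure.pi fun _ : Fin n => Q
  have hρn : Measurable fun (D : Fin n → Ω) (i : Fin n) => ρ₀ (D i) :=
    measurable_pi_lambda _ fun i => hρ.comp (measurable_pi_apply i)
  have hcm : Measurable fun D : Fin n → Ω => count r (fun i => ρ₀ (D i)) :=
    (measurable_count r).comp hρn
  -- The count of the points other than `i`, which is independent of the `i`-th point.
  let c : Fin n → (Fin n → Ω) → ℝ := fun i D => ∑ j ∈ Finset.univ.erase i, ballInd r (ρ₀ (D j))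
  have hc0 : ∀ i D, 0 ≤ c i D := fun i D => Finset.sum_nonneg fun _ _ => ballInd_nonneg _ _
  have hcmeas : ∀ i, Measurable (c i) := fun i => Finset.measurable_fun_sum _ fun j _ =>
    (measurable_ballInd r).comp (hρ.comp (measurable_pi_apply j))
  have hcount : ∀ i D, count r (fun i => ρ₀ (D i)) = ballInd r (ρ₀ (D i)) + c i D := fun i D =>
    (Finset.add_sum_erase _ _ (Finset.mem_univ i)).symm
  have hbm : ∀ i, Measurable fun D : Fin n → Ω => ballInd r (ρ₀ (D i)) := fun i =>
    (measurable_ballInd r).comp (hρ.comp (measurable_pi_apply i))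
  have hp : ∫ z, ballInd r (ρ₀ z) ∂Q = Q.real {z | ρ₀ z ≤ r} := by
    have : (fun z => ballInd r (ρ₀ z)) = Set.indicator {z | ρ₀ z ≤ r} 1 := by
      ext z; simp [ballInd, Set.indicator]
    rw [this]
    exact integral_indicator_one (hρ measurableSet_Iic)
  have hint : ∀ i, Integrable (fun D => ballInd r (ρ₀ (D i)) / (1 + c i D)) P := by
    intro i
    refine integrable_of_abs_le (K := 1) ((hbm i).div ((hcmeas i).const_add 1)) fun D => ?_
    have h1 := hc0 i D
    have h2 := ballInd_nonneg r (ρ₀ (D i))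
    rw [abs_of_nonneg (by positivity), div_le_one (by positivity)]
    linarith [ballInd_le_one r (ρ₀ (D i))]
  have hint2 : Integrable (fun D => 1 / (1 + count r (fun i => ρ₀ (D i)))) P := by
    refine integrable_of_abs_le (K := 1) (measurable_const.div (hcm.const_add 1)) fun D => ?_
    have h1 := count_nonneg r (fun i => ρ₀ (D i))
    rw [abs_of_nonneg (by positivity), div_le_one (by positivity)]
    linarith
  -- Integrating out the `i`-th point turns its indicator into the ball probability; then `c i ≤ N`
  -- gives the inequality.
  have hone : ∀ i, Q.real {z | ρ₀ z ≤ r} * ∫ D, 1 / (1 + count r (fun i => ρ₀ (D i))) ∂P ≤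
      ∫ D, ballInd r (ρ₀ (D i)) / (1 + c i D) ∂P := by
    intro i
    rw [integral_pi_eq_integral_update Q i (hint i), ← integral_const_mul]
    have hcu : ∀ D z, c i (Function.update D i z) = c i D := fun D z =>
      Finset.sum_congr rfl fun j hj => by
        rw [Function.update_of_ne (Finset.ne_of_mem_erase hj)]
    simp_rw [hcu, Function.update_self, integral_div, hp]
    refine integral_mono (hint2.const_mul _) ?_ fun D => ?_
    · refine integrable_of_abs_le (K := 1) (measurable_const.div ((hcmeas i).const_add 1))
        fun D => ?_
      have h1 := hc0 i D
      rw [abs_of_nonneg (by positivity), div_le_one (by positivity)]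
      linarith [measureReal_le_one (μ := Q) (s := {z | ρ₀ z ≤ r})]
    · dsimp only
      rw [mul_one_div]
      have h1 := hc0 i D
      refine div_le_div_of_nonneg_left measureReal_nonneg (by positivity) ?_
      rw [hcount i D]
      linarith [ballInd_nonneg r (ρ₀ (D i))]
  calc _ = ∑ _i : Fin n,
        Q.real {z | ρ₀ z ≤ r} * ∫ D, 1 / (1 + count r (fun i => ρ₀ (D i))) ∂P := by
        simp [mul_assoc]
    _ ≤ ∑ i, ∫ D, ballInd r (ρ₀ (D i)) / (1 + c i D) ∂P := Finset.sum_le_sum fun i _ => hone i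
    _ = ∫ D, ∑ i, ballInd r (ρ₀ (D i)) / (1 + c i D) ∂P :=
        (integral_finsetSum _ fun i _ => hint i).symm
    _ ≤ ∫ _, (1 : ℝ) ∂P := by
        refine integral_mono (integrable_finsetSum _ fun i _ => hint i) (integrable_const _)
          fun D => ?_
        -- If the `i`-th point lies in the ball, then `1 + c i = N`. The sum is therefore `N / N`,
        -- which is `1`, or `0` when `N = 0`.
        have h1 : ∀ i, ballInd r (ρ₀ (D i)) / (1 + c i D) =
            ballInd r (ρ₀ (D i)) / count r (fun i => ρ₀ (D i)) := by
          intro i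
          rw [hcount i D]
          unfold ballInd
          split_ifs <;> simp
        simp only [h1]
        rw [← Finset.sum_div]
        exact div_self_le_one _
    _ = 1 := by simp

/-- Errors that are centred given the radii are uncorrelated, also after multiplication with
functions of the radii. -/
lemma integral_mul_error_mul_error_eq_zero {ρ₀ e : Ω → ℝ} (hρ : Measurable ρ₀)
    (he : Measurable e) {K M : ℝ} (heK : ∀ z, |e z| ≤ K)
    (hcent : ∀ g : ℝ → ℝ, Measurable g → (∃ B, ∀ s, |g s| ≤ B) → ∫ z, g (ρ₀ z) * e z ∂Q = 0)
    {G : (Fin n → ℝ) → ℝ} (hG : Measurable G) (hGM : ∀ v, |G v| ≤ M) {i j : Fin n} (hij : i ≠ j) :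
    ∫ D, G (fun k => ρ₀ (D k)) * (e (D j) * e (D i)) ∂(Measure.pi fun _ : Fin n => Q) = 0 := by
  have hρn : Measurable fun (D : Fin n → Ω) (i : Fin n) => ρ₀ (D i) :=
    measurable_pi_lambda _ fun i => hρ.comp (measurable_pi_apply i)
  rw [integral_pi_eq_integral_update Q i]
  · refine integral_eq_zero_of_ae (Filter.Eventually.of_forall fun D => ?_)
    simp only [Function.update_self, Function.update_of_ne hij.symm, Pi.zero_apply]
    have h1 : ∀ z, (fun k => ρ₀ (Function.update D i z k)) =
        Function.update (fun k => ρ₀ (D k)) i (ρ₀ z) := by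
      intro z
      ext k
      by_cases hk : k = i
      · subst hk; simp
      · simp [hk]
    -- With the other observations frozen, `G` times `e (D j)` is a bounded function of the `i`-th
    -- radius alone.
    have h2 := hcent (fun s => G (Function.update (fun k => ρ₀ (D k)) i s) * e (D j))
      ((hG.comp (measurable_update _)).mul_const _) ⟨M * K, fun s => by
        rw [abs_mul]
        exact mul_le_mul (hGM _) (heK _) (abs_nonneg _) ((abs_nonneg _).trans (hGM 0))⟩
    simpa only [h1, mul_assoc] using h2
  · refine integrable_of_abs_le (K := M * (K * K)) ((hG.comp hρn).mul
      ((he.comp (measurable_pi_apply j)).mul (he.comp (measurable_pi_apply i)))) fun D => ?_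
    rw [abs_mul, abs_mul]
    have hM : 0 ≤ M := (abs_nonneg _).trans (hGM 0)
    have hK : 0 ≤ K := (abs_nonneg _).trans (heK (D i))
    gcongr
    · exact hGM _
    · exact heK _
    · exact heK _

/-- The variance bound for weighted sums of conditionally centred errors. -/
lemma integral_sq_sum_weight_mul_error_le {ρ₀ e : Ω → ℝ} (hρ : Measurable ρ₀)
    (he : Measurable e) {M : ℝ} (heK : ∀ z, |e z| ≤ 1)
    (hcent : ∀ g : ℝ → ℝ, Measurable g → (∃ B, ∀ s, |g s| ≤ B) → ∫ z, g (ρ₀ z) * e z ∂Q = 0)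
    {w : Fin n → (Fin n → ℝ) → ℝ} (hw : ∀ i, Measurable (w i)) (hwM : ∀ i v, |w i v| ≤ M) :
    ∫ D, (∑ i, w i (fun k => ρ₀ (D k)) * e (D i)) ^ 2 ∂(Measure.pi fun _ : Fin n => Q) ≤
      ∫ D, ∑ i, w i (fun k => ρ₀ (D k)) ^ 2 ∂(Measure.pi fun _ : Fin n => Q) := by
  set P := Measure.pi fun _ : Fin n => Q
  have hρn : Measurable fun (D : Fin n → Ω) (i : Fin n) => ρ₀ (D i) :=
    measurable_pi_lambda _ fun i => hρ.comp (measurable_pi_apply i)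
  have hprod : ∀ i j v, |w i v * w j v| ≤ M * M := fun i j v => by
    rw [abs_mul]
    exact mul_le_mul (hwM _ _) (hwM _ _) (abs_nonneg _) ((abs_nonneg _).trans (hwM i v))
  have hmeas : ∀ i j, Measurable fun D : Fin n → Ω =>
      w i (fun k => ρ₀ (D k)) * w j (fun k => ρ₀ (D k)) * (e (D j) * e (D i)) := fun i j =>
    (((hw i).comp hρn).mul ((hw j).comp hρn)).mul
      ((he.comp (measurable_pi_apply j)).mul (he.comp (measurable_pi_apply i)))
  have hint : ∀ i j, Integrable (fun D : Fin n → Ω =>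
      w i (fun k => ρ₀ (D k)) * w j (fun k => ρ₀ (D k)) * (e (D j) * e (D i))) P := by
    intro i j
    refine integrable_of_abs_le (K := M * M * (1 * 1)) (hmeas i j) fun D => ?_
    rw [abs_mul, abs_mul (e _)]
    have := mul_self_nonneg M
    gcongr
    · exact hprod _ _ _
    · exact heK _
    · exact heK _
  have hexp : ∀ D : Fin n → Ω, (∑ i, w i (fun k => ρ₀ (D k)) * e (D i)) ^ 2 =
      ∑ i, ∑ j, w i (fun k => ρ₀ (D k)) * w j (fun k => ρ₀ (D k)) * (e (D j) * e (D i)) := by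
    intro D
    rw [sq, Finset.sum_mul_sum]
    exact Finset.sum_congr rfl fun i _ => Finset.sum_congr rfl fun j _ => by ring
  simp_rw [hexp]
  rw [integral_finsetSum _ fun i _ => integrable_finsetSum _ fun j _ => hint i j]
  have hint2 : ∀ i, Integrable (fun D : Fin n → Ω => w i (fun k => ρ₀ (D k)) ^ 2) P := fun i =>
    integrable_of_abs_le (K := M * M) (((hw i).comp hρn).pow_const 2) fun D => by
      rw [sq]; exact hprod _ _ _
  rw [integral_finsetSum _ fun i _ => hint2 i]
  refine Finset.sum_le_sum fun i _ => ?_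
  rw [integral_finsetSum _ fun j _ => hint i j, Finset.sum_eq_single i]
  · refine integral_mono (hint i i) (hint2 i) fun D => ?_
    dsimp only
    have h1 : e (D i) * e (D i) ≤ 1 := by
      rw [← sq, ← sq_abs]; exact pow_le_one₀ (abs_nonneg _) (heK _)
    rw [← sq]
    exact mul_le_of_le_one_right (sq_nonneg _) h1
  · intro j _ hj
    exact integral_mul_error_mul_error_eq_zero Q hρ he heK hcent ((hw i).mul (hw j))
      (fun v => hprod i j v) hj.symm
  · simp

end Resampling

/-! ### Spherical averages and truncated division of polynomials -/

/-- In polar coordinates, a homogeneous function averages to a multiple of a power of the norm. -/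
lemma exists_integral_norm_mul_homogeneous {d : ℕ} (hd : 0 < d) {h : Cov d → ℝ} {k : ℕ}
    (hh : ∀ t : ℝ, 0 < t → ∀ x, h (t • x) = t ^ k * h x) :
    ∃ c : ℝ, ∀ g : ℝ → ℝ, ∫ x, g ‖x‖ * h x = c * ∫ x : Cov d, g ‖x‖ * ‖x‖ ^ k := by
  have : Nontrivial (Cov d) := by
    have : Nonempty (Fin d) := ⟨⟨0, hd⟩⟩
    infer_instance
  let vol : Measure (Cov d) := volume
  let σ := vol.toSphere
  have hσ : σ.real Set.univ ≠ 0 := by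
    have h1 : σ ≠ 0 := vol.toSphere_ne_zero
    rw [measureReal_def]
    exact (ENNReal.toReal_pos (by simpa using h1) (measure_ne_top _ _)).ne'
  have key : ∀ (H : Cov d → ℝ), (∀ t : ℝ, 0 < t → ∀ x, H (t • x) = t ^ k * H x) →
      ∀ g : ℝ → ℝ, ∫ x, g ‖x‖ * H x =
        (∫ θ, H θ ∂σ) *
          ∫ r, g r.1 * r.1 ^ k ∂(Measure.volumeIoiPow (Module.finrank ℝ (Cov d) - 1)) := by
    intro H hH g
    have h1 : ∫ x, g ‖x‖ * H x = ∫ x : ({(0)}ᶜ : Set (Cov d)), g ‖x.1‖ * H x.1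
        ∂(vol.comap (↑)) := by
      rw [integral_subtype_comap (measurableSet_singleton _).compl fun x : Cov d => g ‖x‖ * H x,
        restrict_compl_singleton]
    have h2 := vol.measurePreserving_homeomorphUnitSphereProd.integral_comp
      (Homeomorph.measurableEmbedding _)
      (fun p : Metric.sphere (0 : Cov d) 1 × Set.Ioi (0 : ℝ) => H p.1 * (g p.2.1 * p.2.1 ^ k))
    rw [h1, ← integral_prod_mul, ← h2]
    refine integral_congr_ae (Filter.Eventually.of_forall fun x => ?_)
    have hx : 0 < ‖x.1‖ := norm_pos_iff.mpr x.2
    simp only [homeomorphUnitSphereProd_apply_fst_coe, homeomorphUnitSphereProd_apply_snd_coe]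
    have h3 := hH ‖x.1‖ hx (‖x.1‖⁻¹ • x.1)
    rw [smul_smul, mul_inv_cancel₀ hx.ne', one_smul] at h3
    rw [h3]
    ring
  -- The constant is the mean of `h` over the unit sphere: `h` and the `k`-th power of the norm have
  -- the same radial factor in `key`.
  refine ⟨(∫ θ, h θ ∂σ) / σ.real Set.univ, fun g => ?_⟩
  rw [key h hh g, key (fun x => ‖x‖ ^ k)
    (fun t ht x => by rw [norm_smul, Real.norm_of_nonneg ht.le, mul_pow]) g]
  have h4 : ∫ θ, ‖(θ : Cov d)‖ ^ k ∂σ = σ.real Set.univ := by simp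
  rw [h4]
  field_simp

lemma integrable_norm_mul_continuous {d : ℕ} {g : ℝ → ℝ} (hg : Measurable g) {M R : ℝ}
    (hM : ∀ s, |g s| ≤ M) (hR : ∀ s, R < s → g s = 0) {F : Cov d → ℝ} (hF : Continuous F) :
    Integrable fun x => g ‖x‖ * F x := by
  have h1 : IntegrableOn (fun x => g ‖x‖ * F x) (Metric.closedBall (0 : Cov d) R) :=
    (hF.continuousOn.integrableOn_compact (isCompact_closedBall _ _)).bdd_mul
      (hg.comp measurable_norm).aestronglyMeasurable (Filter.Eventually.of_forall fun x => hM ‖x‖)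
  refine (integrableOn_iff_integrable_of_support_subset ?_).mp h1
  intro x hx
  rw [mem_closedBall_zero_iff]
  by_contra hlt
  exact hx (by simp [hR _ (not_le.mp hlt)])

lemma continuous_eval_coord {d : ℕ} (b : MvPolynomial (Fin d) ℝ) :
    Continuous fun x : Cov d => MvPolynomial.eval (fun j => x j) b :=
  (MvPolynomial.continuous_eval b).comp (continuous_pi fun j => by fun_prop)

/-- The average of a polynomial over centred spheres is a polynomial in the squared radius. -/
lemma exists_radial_average {d : ℕ} (hd : 0 < d) (b : MvPolynomial (Fin d) ℝ) :
    ∃ A : Polynomial ℝ, A.coeff 0 = MvPolynomial.eval (fun _ => (0 : ℝ)) b ∧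
      ∀ g : ℝ → ℝ, Measurable g → ∀ M R : ℝ, (∀ s, |g s| ≤ M) → (∀ s, R < s → g s = 0) →
        ∫ x : Cov d, g ‖x‖ * MvPolynomial.eval (fun j => x j) b =
          ∫ x : Cov d, g ‖x‖ * A.eval (‖x‖ ^ 2) := by
  induction b using MvPolynomial.induction_on' with
  | monomial u a =>
    by_cases hu : u = 0
    · subst hu
      exact ⟨Polynomial.C a, by simp, fun g _ M R _ _ => by simp⟩
    have hev : ∀ x : Cov d, MvPolynomial.eval (fun j => x j) (MvPolynomial.monomial u a) =
        a * ∏ j, x j ^ u j := fun x => by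
      rw [MvPolynomial.eval_monomial, Finsupp.prod_fintype _ _ fun _ => pow_zero _]
    set k := ∑ j, u j with hk
    have hk0 : k ≠ 0 := by
      intro h0
      apply hu
      ext j
      exact (Finset.sum_eq_zero_iff.mp h0) j (Finset.mem_univ j)
    have hhom : ∀ (t : ℝ) (x : Cov d), ∏ j, (t • x) j ^ u j = t ^ k * ∏ j, x j ^ u j := by
      intro t x
      rw [hk, ← Finset.prod_pow_eq_pow_sum, ← Finset.prod_mul_distrib]
      exact Finset.prod_congr rfl fun j _ => by rw [PiLp.smul_apply, smul_eq_mul, mul_pow]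
    have hev0 : MvPolynomial.eval (fun _ => (0 : ℝ)) (MvPolynomial.monomial u a) = 0 := by
      obtain ⟨j, hj⟩ : ∃ j, u j ≠ 0 := by
        by_contra! h
        exact hu (Finsupp.ext h)
      rw [MvPolynomial.eval_monomial, Finsupp.prod_fintype _ _ fun _ => pow_zero _,
        Finset.prod_eq_zero (Finset.mem_univ j) (zero_pow hj), mul_zero]
    simp_rw [hev, hev0]
    -- Even degree `2 j` averages to a multiple of `(‖x‖ ^ 2) ^ j`, with `j ≠ 0`; odd degree cancels
    -- under `x ↦ -x`.
    rcases Nat.even_or_odd' k with ⟨j, hj | hj⟩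
    · obtain ⟨c, hc⟩ := exists_integral_norm_mul_homogeneous hd (k := k)
        (h := fun x : Cov d => ∏ j, x j ^ u j) fun t _ x => hhom t x
      refine ⟨Polynomial.C (a * c) * Polynomial.X ^ j, ?_, fun g _ M R _ _ => ?_⟩
      · rw [Polynomial.coeff_C_mul_X_pow, if_neg (by omega)]
      · have h1 : ∀ x : Cov d, g ‖x‖ * (a * ∏ j, x j ^ u j) = a * (g ‖x‖ * ∏ j, x j ^ u j) :=
          fun x => by ring
        have h2 : ∀ x : Cov d, g ‖x‖ * (Polynomial.C (a * c) * Polynomial.X ^ j).eval (‖x‖ ^ 2) =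
            (a * c) * (g ‖x‖ * ‖x‖ ^ k) := fun x => by
          simp only [Polynomial.eval_mul, Polynomial.eval_C, Polynomial.eval_pow,
            Polynomial.eval_X, hj, pow_mul]
          ring
        simp_rw [h1, h2]
        rw [integral_const_mul, integral_const_mul, hc g, mul_assoc]
    · refine ⟨0, by simp, fun g _ M R _ _ => ?_⟩
      have hodd : ∀ x : Cov d, g ‖-x‖ * (a * ∏ j, (-x) j ^ u j) =
          -(g ‖x‖ * (a * ∏ j, x j ^ u j)) := fun x => by
        have := hhom (-1) x
        rw [neg_one_smul, Odd.neg_one_pow ⟨j, hj⟩] at this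
        rw [this, norm_neg]
        ring
      have h1 := integral_neg_eq_self (fun x : Cov d => g ‖x‖ * (a * ∏ j, x j ^ u j)) volume
      simp_rw [hodd] at h1
      rw [integral_neg] at h1
      simp only [Polynomial.eval_zero, mul_zero, integral_zero]
      linarith
  | add p q hp hq =>
    obtain ⟨A, hA0, hA⟩ := hp
    obtain ⟨B, hB0, hB⟩ := hq
    refine ⟨A + B, by simp [hA0, hB0], fun g hg M R hM hR => ?_⟩
    have hI : ∀ {F : Cov d → ℝ}, Continuous F → Integrable fun x => g ‖x‖ * F x :=
      integrable_norm_mul_continuous hg hM hR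
    simp only [map_add, Polynomial.eval_add, mul_add]
    have hN : ∀ P : Polynomial ℝ, Integrable fun x : Cov d => g ‖x‖ * P.eval (‖x‖ ^ 2) :=
      fun P => hI (F := fun x => P.eval (‖x‖ ^ 2)) (P.continuous.comp (continuous_norm.pow 2))
    rw [integral_add (hI (continuous_eval_coord p)) (hI (continuous_eval_coord q)),
      integral_add (hN A) (hN B), hA g hg M R hM hR, hB g hg M R hM hR]

/-- Division of polynomials up to a given order. -/
lemma exists_truncated_quotient {A B : Polynomial ℝ} (hB : B.coeff 0 ≠ 0) (k : ℕ) :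
    ∃ p q : Polynomial ℝ, p.natDegree ≤ k ∧ p.coeff 0 * B.coeff 0 = A.coeff 0 ∧
      A - p * B = Polynomial.X ^ (k + 1) * q := by
  induction k with
  | zero =>
    refine ⟨Polynomial.C (A.coeff 0 / B.coeff 0),
      (A - Polynomial.C (A.coeff 0 / B.coeff 0) * B).divX, by simp, by simp [hB], ?_⟩
    have h0 : (A - Polynomial.C (A.coeff 0 / B.coeff 0) * B).coeff 0 = 0 := by
      simp [hB]
    have h1 := Polynomial.divX_mul_X_add (A - Polynomial.C (A.coeff 0 / B.coeff 0) * B)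
    rw [h0, Polynomial.C_0, add_zero] at h1
    rw [zero_add, pow_one, mul_comm Polynomial.X, h1]
  | succ k ih =>
    obtain ⟨p, q, hdeg, h0, hpq⟩ := ih
    -- The next coefficient of the power series `A / B`: it makes the constant term of `q - c B`
    -- vanish, so the remainder gains a factor `X`.
    set c := q.coeff 0 / B.coeff 0
    refine ⟨p + Polynomial.C c * Polynomial.X ^ (k + 1), (q - Polynomial.C c * B).divX, ?_, ?_, ?_⟩
    · refine (Polynomial.natDegree_add_le _ _).trans (max_le (by omega) ?_)
      exact Polynomial.natDegree_C_mul_X_pow_le _ _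
    · simp [h0, Polynomial.coeff_X_pow]
    · have h2 : (q - Polynomial.C c * B).coeff 0 = 0 := by simp [c, hB]
      have h1 := Polynomial.divX_mul_X_add (q - Polynomial.C c * B)
      rw [h2, Polynomial.C_0, add_zero] at h1
      rw [pow_succ _ (k + 1), mul_assoc, mul_comm Polynomial.X, h1, add_mul, ← sub_sub, hpq]
      ring

/-! ### Conditioning the label on the distance -/

section Regression

variable {d : ℕ} {Q : Measure (Cov d × ℝ)} {μ η : Cov d → ℝ}

/-- The distance of the covariate to the centre. -/
def dist₀ (x₀ : Cov d) (z : Cov d × ℝ) : ℝ := ‖z.1 - x₀‖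

/-- The indicator of the label `1`. -/
def labelInd (z : Cov d × ℝ) : ℝ := if z.2 = 1 then 1 else 0

lemma measurable_dist₀ (x₀ : Cov d) : Measurable (dist₀ x₀) :=
  (measurable_fst.sub_const x₀).norm

lemma measurable_labelInd : Measurable (labelInd : Cov d × ℝ → ℝ) :=
  Measurable.ite (measurable_snd (measurableSet_singleton 1)) measurable_const measurable_const

/-- The conditional label probability given the distance to the centre. -/
lemma exists_radial_prob [IsProbabilityMeasure Q] (x₀ : Cov d) (hQ : IsLabelModel Q μ η) :
    ∃ m : ℝ → ℝ, Measurable m ∧ (∀ s, 0 ≤ m s ∧ m s ≤ 1) ∧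
      (∀ g : ℝ → ℝ, Measurable g → (∃ B, ∀ s, |g s| ≤ B) →
        ∫ z, g (dist₀ x₀ z) * (labelInd z - m (dist₀ x₀ z)) ∂Q = 0) ∧
      Integrable (fun z => η z.1) Q ∧
      ∀ A : Set ℝ, MeasurableSet A → ∫ z in dist₀ x₀ ⁻¹' A, m (dist₀ x₀ z) ∂Q =
        ∫ z in dist₀ x₀ ⁻¹' A, η z.1 ∂Q := by
  have hρ := measurable_dist₀ x₀
  let κ := condDistrib Prod.snd (dist₀ x₀) Q
  -- A regular conditional law gives a function of the radius with values in `[0, 1]` everywhere,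
  -- not only almost everywhere.
  let m : ℝ → ℝ := fun s => (κ s).real {1}
  have hm : Measurable m := (κ.measurable_coe (measurableSet_singleton 1)).ennreal_toReal
  have hm01 : ∀ s, 0 ≤ m s ∧ m s ≤ 1 := fun s => ⟨measureReal_nonneg, measureReal_le_one⟩
  have hle := hρ.comap_le
  have hind : (Set.indicator (Prod.snd ⁻¹' {1}) fun _ => (1 : ℝ)) =
      (labelInd : Cov d × ℝ → ℝ) := by
    ext z; simp [labelInd, Set.indicator]
  have hyint : Integrable labelInd Q :=
    integrable_of_abs_le (K := 1) measurable_labelInd fun z => by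
      unfold labelInd; split_ifs <;> norm_num
  have hcond : (fun z => m (dist₀ x₀ z)) =ᵐ[Q]
      Q[labelInd | MeasurableSpace.comap (dist₀ x₀) inferInstance] := by
    rw [← hind]
    exact condDistrib_ae_eq_condExp hρ measurable_snd (measurableSet_singleton 1)
  have hη : Q[labelInd | MeasurableSpace.comap Prod.fst inferInstance] =ᵐ[Q] fun z => η z.1 := by
    have := hQ.prob
    rw [← hind]
    exact this
  refine ⟨m, hm, hm01, ?_, integrable_condExp.congr hη, ?_⟩
  · rintro g hg ⟨B, hB⟩
    have hgs : StronglyMeasurable[MeasurableSpace.comap (dist₀ x₀) inferInstance]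
        fun z => g (dist₀ x₀ z) := (hg.comp (comap_measurable _)).stronglyMeasurable
    have h1 := condExp_stronglyMeasurable_mul_of_bound hle hgs hyint B
      (Filter.Eventually.of_forall fun z => hB _)
    have h2 : ∫ z, g (dist₀ x₀ z) * labelInd z ∂Q =
        ∫ z, g (dist₀ x₀ z) * m (dist₀ x₀ z) ∂Q := by
      rw [← integral_condExp hle]
      refine integral_congr_ae (h1.trans ?_)
      filter_upwards [hcond] with z hz
      simp [hz]
    have hgm : ∀ {F : Cov d × ℝ → ℝ}, Integrable F Q →
        Integrable (fun z => g (dist₀ x₀ z) * F z) Q := fun hF =>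
      hF.bdd_mul (hg.comp hρ).aestronglyMeasurable (Filter.Eventually.of_forall fun z => hB _)
    have hmint : Integrable (fun z => m (dist₀ x₀ z)) Q :=
      integrable_of_abs_le (K := 1) (hm.comp hρ) fun z => by
        rw [abs_of_nonneg (hm01 _).1]; exact (hm01 _).2
    simp_rw [mul_sub]
    rw [integral_sub (hgm hyint) (hgm hmint), h2, sub_self]
  · intro A hA
    have hfst : (inferInstance : MeasurableSpace (Cov d × ℝ)) ≥
      MeasurableSpace.comap Prod.fst inferInstance := measurable_fst.comap_le
    -- The event that the distance lies in `A` is measurable for both conditioning σ-algebras, so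
    -- both integrals equal that of the label indicator.
    rw [integral_congr_ae (ae_restrict_of_ae hcond), integral_congr_ae (ae_restrict_of_ae hη.symm),
      setIntegral_condExp hle hyint ⟨A, hA, rfl⟩, setIntegral_condExp hfst hyint]
    exact ⟨(fun x => ‖x - x₀‖) ⁻¹' A, ((measurable_id.sub_const x₀).norm) hA, rfl⟩

lemma integral_comp_fst_eq (hQ : IsLabelModel Q μ η) {F : Cov d → ℝ} (hF : Measurable F) :
    ∫ z, F z.1 ∂Q = ∫ x, μ x * F x := by
  rw [← integral_map (φ := Prod.fst) measurable_fst.aemeasurable hF.aestronglyMeasurable,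
    hQ.density, integral_withDensity_eq_integral_toReal_smul
      hQ.density_measurable.ennreal_ofReal (by simp)]
  refine integral_congr_ae (Filter.Eventually.of_forall fun x => ?_)
  simp [ENNReal.toReal_ofReal (hQ.density_nonneg x)]

lemma integrable_density_mul (hQ : IsLabelModel Q μ η) {F : Cov d → ℝ} (hF : Measurable F)
    (hint : Integrable (fun z => F z.1) Q) : Integrable fun x => μ x * F x := by
  have h1 : Integrable F (Q.map Prod.fst) :=
    (integrable_map_measure hF.aestronglyMeasurable measurable_fst.aemeasurable).mpr hint
  rw [hQ.density, integrable_withDensity_iff_integrable_smul'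
    hQ.density_measurable.ennreal_ofReal (by simp)] at h1
  refine h1.congr (Filter.Eventually.of_forall fun x => ?_)
  simp [ENNReal.toReal_ofReal (hQ.density_nonneg x)]

end Regression

/-! ### Radial expansion of the regression function -/

section Bias

variable {d : ℕ} {Q : Measure (Cov d × ℝ)} {μ η : Cov d → ℝ}

lemma exists_bound_eval_sq (p : Polynomial ℝ) :
    ∃ M : ℝ, 0 ≤ M ∧ ∀ s ∈ Set.Icc (0 : ℝ) 1, |p.eval (s ^ 2)| ≤ M := by
  obtain ⟨M, hM⟩ := (isCompact_Icc (a := (0 : ℝ)) (b := 1)).exists_bound_of_continuousOn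
    (f := fun s => p.eval (s ^ 2)) (by fun_prop)
  exact ⟨M, (norm_nonneg _).trans (hM 0 (by simp)), hM⟩

/-- The regression function, averaged over spheres, is an even polynomial of the radius up to an
error of the order of the Hölder exponent. -/
lemma exists_radial_expansion (hd : 0 < d) {β R : ℝ} (hβ : 0 < β) (hR : R ≤ 1) {x₀ : Cov d}
    (hμ : Measurable μ) (hη : Measurable η) (hμ₀ : μ x₀ ≠ 0) (h₁ : HolderOnBall β x₀ R μ)
    (h₂ : HolderOnBall β x₀ R fun x => η x * μ x) {ω : ℕ} (hω : β ≤ 2 * ((ω : ℝ) + 1)) :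
    ∃ p : Polynomial ℝ, p.natDegree ≤ ω ∧ p.coeff 0 = η x₀ ∧ ∃ K : ℝ, 0 ≤ K ∧
      ∀ A : Set ℝ, MeasurableSet A → A ⊆ Set.Icc 0 R →
        |∫ x, μ x * (A.indicator 1 ‖x - x₀‖ * (η x - p.eval (‖x - x₀‖ ^ 2)))| ≤
          K * ∫ x : Cov d, A.indicator 1 ‖x‖ * ‖x‖ ^ β := by
  obtain ⟨b₁, -, hb₁, L₁, hL₁, hH₁⟩ := h₁
  obtain ⟨b₂, -, hb₂, L₂, hL₂, hH₂⟩ := h₂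
  obtain ⟨A₁, hA₁0, hA₁⟩ := exists_radial_average hd (b₁ + MvPolynomial.C (μ x₀))
  obtain ⟨A₂, hA₂0, hA₂⟩ := exists_radial_average hd (b₂ + MvPolynomial.C (η x₀ * μ x₀))
  simp only [map_add, hb₁, hb₂, MvPolynomial.eval_C, zero_add] at hA₁0 hA₂0 hA₁ hA₂
  -- `A₁` and `A₂` are the averaged expansions of `μ` and `η μ`. Their truncated quotient `p` has
  -- constant term `η x₀`, and the remainder is `s ^ (2(ω + 1)) q(s ^ 2)`.
  obtain ⟨p, q, hdeg, hp0, hpq⟩ := exists_truncated_quotient (A := A₂) (B := A₁)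
    (by rwa [hA₁0]) ω
  rw [hA₁0, hA₂0] at hp0
  obtain ⟨Mp, hMp0, hMp⟩ := exists_bound_eval_sq p
  obtain ⟨Mq, hMq0, hMq⟩ := exists_bound_eval_sq q
  refine ⟨p, hdeg, mul_right_cancel₀ hμ₀ hp0, L₂ + Mp * L₁ + Mq, by positivity, ?_⟩
  intro A hA hAR
  set g : ℝ → ℝ := A.indicator 1 with hgdef
  have hg : Measurable g := measurable_one.indicator hA
  have hg01 : ∀ s, 0 ≤ g s ∧ g s ≤ 1 := fun s => by
    simp only [hgdef, Set.indicator]; split_ifs <;> simp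
  have hgb : ∀ s, |g s| ≤ 1 := fun s => by rw [abs_of_nonneg (hg01 s).1]; exact (hg01 s).2
  have hgmem : ∀ s, g s ≠ 0 → s ∈ Set.Icc 0 R := fun s hs => hAR (Set.mem_of_indicator_ne_zero hs)
  have hgR : ∀ s, R < s → g s = 0 := fun s hs => by
    by_contra h; exact (hgmem s h).2.not_gt hs
  let gp : ℝ → ℝ := fun s => g s * p.eval (s ^ 2)
  have hgp : Measurable gp := hg.mul (p.continuous.measurable.comp (measurable_id.pow_const 2))
  have hgpb : ∀ s, |gp s| ≤ Mp := fun s => by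
    by_cases h : g s = 0
    · simp only [gp, h, zero_mul, abs_zero]; exact hMp0
    · have := hgmem s h
      rw [abs_mul]
      exact (mul_le_of_le_one_left (abs_nonneg _) (hgb s)).trans
        (hMp s ⟨this.1, this.2.trans hR⟩)
  have hgpR : ∀ s, R < s → gp s = 0 := fun s hs => by simp [gp, hgR s hs]
  let P₁ : Cov d → ℝ := fun u => MvPolynomial.eval (fun j => u j) b₁ + μ x₀
  let P₂ : Cov d → ℝ := fun u => MvPolynomial.eval (fun j => u j) b₂ + η x₀ * μ x₀
  have hP₁ : Continuous P₁ := (continuous_eval_coord b₁).add continuous_const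
  have hP₂ : Continuous P₂ := (continuous_eval_coord b₂).add continuous_const
  -- After centring at `x₀`, `H` is the integrand, `T` is `H` with `μ` and `η μ` replaced by their
  -- polynomials, and `W` is the dominating function.
  let H : Cov d → ℝ := fun u => μ (u + x₀) * (g ‖u‖ * (η (u + x₀) - p.eval (‖u‖ ^ 2)))
  let T : Cov d → ℝ := fun u => g ‖u‖ * P₂ u - gp ‖u‖ * P₁ u
  let W : Cov d → ℝ := fun u => g ‖u‖ * ‖u‖ ^ β
  have hW : Integrable W := integrable_norm_mul_continuous hg hgb hgR
    (continuous_norm.rpow_const fun _ => Or.inr hβ.le)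
  have hT₂ : Integrable fun u => g ‖u‖ * P₂ u := integrable_norm_mul_continuous hg hgb hgR hP₂
  have hT₁ : Integrable fun u => gp ‖u‖ * P₁ u :=
    integrable_norm_mul_continuous hgp hgpb hgpR hP₁
  have hT : Integrable T := hT₂.sub hT₁
  have hHm : Measurable H := by
    have hs : Measurable fun u : Cov d => u + x₀ := measurable_id.add_const x₀
    exact (hμ.comp hs).mul ((hg.comp measurable_norm).mul ((hη.comp hs).sub
      (p.continuous.measurable.comp (measurable_norm.pow_const 2))))
  have hHT : ∀ u, |H u - T u| ≤ (L₂ + Mp * L₁) * W u := by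
    intro u
    by_cases h : g ‖u‖ = 0
    · simp [H, T, W, gp, h]
    have hu := hgmem _ h
    have hball : u + x₀ ∈ Metric.closedBall x₀ R := by
      rw [mem_closedBall_iff_norm, add_sub_cancel_right]; exact hu.2
    have e₁ := hH₁ _ hball
    have e₂ := hH₂ _ hball
    simp only [PiLp.add_apply, add_sub_cancel_right] at e₁ e₂
    have hp := hMp ‖u‖ ⟨hu.1, hu.2.trans hR⟩
    have hid : H u - T u = g ‖u‖ * ((η (u + x₀) * μ (u + x₀) - η x₀ * μ x₀ -
        MvPolynomial.eval (fun j => u j) b₂) - p.eval (‖u‖ ^ 2) * (μ (u + x₀) - μ x₀ -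
        MvPolynomial.eval (fun j => u j) b₁)) := by
      simp only [H, T, gp, P₁, P₂]; ring
    rw [hid, abs_mul, abs_of_nonneg (hg01 _).1]
    have hb : |(η (u + x₀) * μ (u + x₀) - η x₀ * μ x₀ -
        MvPolynomial.eval (fun j => u j) b₂) - p.eval (‖u‖ ^ 2) * (μ (u + x₀) - μ x₀ -
        MvPolynomial.eval (fun j => u j) b₁)| ≤ L₂ * ‖u‖ ^ β + Mp * (L₁ * ‖u‖ ^ β) := by
      refine (abs_sub _ _).trans (add_le_add e₂ ?_)
      rw [abs_mul]
      exact mul_le_mul hp e₁ (abs_nonneg _) hMp0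
    calc _ ≤ g ‖u‖ * (L₂ * ‖u‖ ^ β + Mp * (L₁ * ‖u‖ ^ β)) :=
          mul_le_mul_of_nonneg_left hb (hg01 _).1
      _ = _ := by simp only [W]; ring
  have hHTint : Integrable (H - T) := (hW.const_mul (L₂ + Mp * L₁)).mono'
    (hHm.aestronglyMeasurable.sub hT.1) (Filter.Eventually.of_forall hHT)
  -- The cancellation is not pointwise: only after integration may the polynomials be replaced by
  -- their spherical averages. Here `p` is absorbed into the radial factor `gp`.
  have hTint : ∫ u, T u = ∫ u : Cov d, g ‖u‖ * (‖u‖ ^ (2 * (ω + 1)) * q.eval (‖u‖ ^ 2)) := by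
    have hc : ∀ P : Polynomial ℝ, Continuous fun u : Cov d => P.eval (‖u‖ ^ 2) := fun P =>
      P.continuous.comp (continuous_norm.pow 2)
    have hI₂ := integrable_norm_mul_continuous hg hgb hgR (hc A₂)
    have hI₁ := integrable_norm_mul_continuous hgp hgpb hgpR (hc A₁)
    calc ∫ u, T u = (∫ u, g ‖u‖ * P₂ u) - ∫ u, gp ‖u‖ * P₁ u := integral_sub hT₂ hT₁
      _ = (∫ u : Cov d, g ‖u‖ * A₂.eval (‖u‖ ^ 2)) -
          ∫ u : Cov d, gp ‖u‖ * A₁.eval (‖u‖ ^ 2) := by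
          rw [hA₂ g hg 1 R hgb hgR, hA₁ gp hgp Mp R hgpb hgpR]
      _ = ∫ u : Cov d, (g ‖u‖ * A₂.eval (‖u‖ ^ 2) - gp ‖u‖ * A₁.eval (‖u‖ ^ 2)) :=
          (integral_sub hI₂ hI₁).symm
      _ = _ := by
          refine integral_congr_ae (Filter.Eventually.of_forall fun u => ?_)
          have h := congrArg (Polynomial.eval (‖u‖ ^ 2)) hpq
          simp only [Polynomial.eval_sub, Polynomial.eval_mul, Polynomial.eval_pow,
            Polynomial.eval_X, ← pow_mul] at h
          dsimp only
          rw [← h]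
          simp only [gp]
          ring
  have hTle : |∫ u, T u| ≤ Mq * ∫ u, W u := by
    rw [hTint, ← integral_const_mul, ← Real.norm_eq_abs]
    refine norm_integral_le_of_norm_le (hW.const_mul Mq) (Filter.Eventually.of_forall fun u => ?_)
    by_cases h : g ‖u‖ = 0
    · simp [W, h]
    have hu := hgmem _ h
    have hq := hMq ‖u‖ ⟨hu.1, hu.2.trans hR⟩
    -- Uses `‖u‖ ≤ 1` and `β ≤ 2(ω + 1)`; at `u = 0` both sides are zero.
    have hpow : ‖u‖ ^ (2 * (ω + 1)) ≤ ‖u‖ ^ β := by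
      rcases hu.1.eq_or_lt with h0 | h0
      · rw [← h0, zero_pow (by omega), Real.zero_rpow hβ.ne']
      · rw [← Real.rpow_natCast]
        refine Real.rpow_le_rpow_of_exponent_ge h0 (hu.2.trans hR) ?_
        push_cast
        exact hω
    rw [Real.norm_eq_abs, abs_mul, abs_mul, abs_of_nonneg (hg01 _).1,
      abs_of_nonneg (pow_nonneg hu.1 _)]
    calc _ ≤ g ‖u‖ * (‖u‖ ^ β * Mq) := by
          refine mul_le_mul_of_nonneg_left ?_ (hg01 _).1
          exact mul_le_mul hpow hq (abs_nonneg _) (Real.rpow_nonneg hu.1 _)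
      _ = _ := by simp only [W]; ring
  have hshift : ∫ x, μ x * (g ‖x - x₀‖ * (η x - p.eval (‖x - x₀‖ ^ 2))) = ∫ u, H u := by
    rw [← integral_add_right_eq_self _ x₀]
    simp only [add_sub_cancel_right, H]
  rw [hshift]
  have hsplit : ∫ u, H u = (∫ u, (H - T) u) + ∫ u, T u := by
    rw [← integral_add hHTint hT]
    simp
  rw [hsplit, add_mul]
  refine (abs_add_le _ _).trans (add_le_add ?_ hTle)
  rw [← integral_const_mul, ← Real.norm_eq_abs]
  exact norm_integral_le_of_norm_le (hW.const_mul _) (Filter.Eventually.of_forall hHT)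

/-- The conditional label probability given the radius is an even polynomial of the radius up to an
error of the order of the Hölder exponent. -/
lemma ae_abs_radial_prob_sub_le [IsProbabilityMeasure Q] (hd : 0 < d) {β R : ℝ} (hβ : 0 < β)
    (hR : R ∈ Set.Ioo (0 : ℝ) 1) {x₀ : Cov d} (hQ : IsLabelModel Q μ η)
    (hlow : LowerBoundedOnBall x₀ R μ) (h₁ : HolderOnBall β x₀ R μ)
    (h₂ : HolderOnBall β x₀ R fun x => η x * μ x) {ω : ℕ} (hω : β ≤ 2 * ((ω : ℝ) + 1))
    {m : ℝ → ℝ} (hm : Measurable m) (hm01 : ∀ s, 0 ≤ m s ∧ m s ≤ 1)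
    (hηint : Integrable (fun z => η z.1) Q)
    (hset : ∀ A : Set ℝ, MeasurableSet A → ∫ z in dist₀ x₀ ⁻¹' A, m (dist₀ x₀ z) ∂Q =
        ∫ z in dist₀ x₀ ⁻¹' A, η z.1 ∂Q) :
    ∃ θ : Fin ω → ℝ, ∃ C : ℝ, 0 ≤ C ∧ ∀ᵐ z ∂Q, dist₀ x₀ z ≤ R →
      |m (dist₀ x₀ z) - (η x₀ + ∑ a, θ a * dist₀ x₀ z ^ (2 * ((a : ℕ) + 1)))| ≤
        C * dist₀ x₀ z ^ β := by
  obtain ⟨l, hl, hlow⟩ := hlow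
  have hμ₀ : μ x₀ ≠ 0 := (hl.trans_le (hlow x₀ (Metric.mem_closedBall_self hR.1.le))).ne'
  obtain ⟨p, hdeg, hp0, K, hK, hexp⟩ := exists_radial_expansion hd hβ hR.2.le
    hQ.density_measurable hQ.prob_measurable hμ₀ h₁ h₂ hω
  have hpe : ∀ s : ℝ, p.eval (s ^ 2) =
      η x₀ + ∑ a : Fin ω, p.coeff (a + 1) * s ^ (2 * ((a : ℕ) + 1)) := by
    intro s
    rw [Polynomial.eval_eq_sum_range' (Nat.lt_succ_of_le hdeg), Finset.sum_range_succ', hp0,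
      Fin.sum_univ_eq_sum_range (fun a => p.coeff (a + 1) * s ^ (2 * (a + 1)))]
    simp only [pow_zero, mul_one, ← pow_mul]
    ring
  refine ⟨fun a => p.coeff (a + 1), K / l, by positivity, ?_⟩
  simp_rw [← hpe]
  have hρ := measurable_dist₀ x₀
  have hpm : Measurable fun s : ℝ => p.eval (s ^ 2) :=
    p.continuous.measurable.comp (measurable_id.pow_const 2)
  have hbm : Measurable fun s : ℝ => s ^ β := (Real.continuous_rpow_const hβ.le).measurable
  let ν := Q.map (dist₀ x₀)
  have : IsProbabilityMeasure ν := Measure.isProbabilityMeasure_map hρ.aemeasurable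
  let I := Set.Icc (0 : ℝ) R
  have hI : MeasurableSet I := measurableSet_Icc
  obtain ⟨Mp, hMp0, hMp⟩ := exists_bound_eval_sq p
  have hintm : IntegrableOn m I ν := (integrable_of_abs_le (K := 1) hm fun s => by
    rw [abs_of_nonneg (hm01 s).1]; exact (hm01 s).2).integrableOn
  have hintp : IntegrableOn (fun s : ℝ => p.eval (s ^ 2)) I ν :=
    Measure.integrableOn_of_bounded (M := Mp) (measure_ne_top _ _) hpm.aestronglyMeasurable
      ((ae_restrict_mem hI).mono fun s hs => hMp s ⟨hs.1, hs.2.trans hR.2.le⟩)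
  have hintb : IntegrableOn (fun s : ℝ => s ^ β) I ν :=
    Measure.integrableOn_of_bounded (M := 1) (measure_ne_top _ _) hbm.aestronglyMeasurable
      ((ae_restrict_mem hI).mono fun s hs => by
        rw [Real.norm_of_nonneg (Real.rpow_nonneg hs.1 _)]
        exact Real.rpow_le_one hs.1 (hs.2.trans hR.2.le) hβ.le)
  -- Comparing integrals over all Borel sets of radii gives the almost sure bound under the law `ν`
  -- of the distance, without disintegrating over spheres.
  have key : ∀ A : Set ℝ, MeasurableSet A → A ⊆ I →
      |∫ s in A, (m s - p.eval (s ^ 2)) ∂ν| ≤ ∫ s in A, K / l * s ^ β ∂ν := by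
    intro A hA hAI
    have hA' : MeasurableSet (dist₀ x₀ ⁻¹' A) := hρ hA
    have hnm : Measurable fun x : Cov d => ‖x - x₀‖ := (measurable_id.sub_const x₀).norm
    have hind : Measurable fun x : Cov d => A.indicator (1 : ℝ → ℝ) ‖x - x₀‖ :=
      (measurable_one.indicator hA).comp hnm
    have hconv : ∀ F : Cov d → ℝ, Measurable F → ∫ z in dist₀ x₀ ⁻¹' A, F z.1 ∂Q =
        ∫ x, μ x * (A.indicator 1 ‖x - x₀‖ * F x) := by
      intro F hF
      rw [← integral_comp_fst_eq hQ (Measurable.fun_mul hind hF), ← integral_indicator hA']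
      refine integral_congr_ae (Filter.Eventually.of_forall fun z => ?_)
      by_cases hz : dist₀ x₀ z ∈ A
      · have hz' : ‖z.1 - x₀‖ ∈ A := hz
        simp [hz, hz']
      · have hz' : ‖z.1 - x₀‖ ∉ A := hz
        simp [hz, hz']
    have e1 : ∫ s in A, (m s - p.eval (s ^ 2)) ∂ν =
        ∫ x, μ x * (A.indicator 1 ‖x - x₀‖ * (η x - p.eval (‖x - x₀‖ ^ 2))) := by
      have hp1 : IntegrableOn (fun z => p.eval (dist₀ x₀ z ^ 2)) (dist₀ x₀ ⁻¹' A) Q :=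
        ((integrable_map_measure (hpm.aestronglyMeasurable) hρ.aemeasurable).mp
          (by rw [← Measure.restrict_map hρ hA]; exact hintp.mono_set hAI))
      rw [integral_sub (hintm.mono_set hAI) (hintp.mono_set hAI),
        setIntegral_map hA hm.aestronglyMeasurable hρ.aemeasurable,
        setIntegral_map hA hpm.aestronglyMeasurable hρ.aemeasurable, hset A hA,
        ← integral_sub hηint.integrableOn hp1]
      exact hconv (fun x => η x - p.eval (‖x - x₀‖ ^ 2)) (hQ.prob_measurable.sub (hpm.comp hnm))
    have e2 : ∫ s in A, K / l * s ^ β ∂ν =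
        K / l * ∫ x, μ x * (A.indicator 1 ‖x - x₀‖ * ‖x - x₀‖ ^ β) := by
      rw [integral_const_mul, setIntegral_map hA hbm.aestronglyMeasurable hρ.aemeasurable]
      congr 1
      exact hconv (fun x => ‖x - x₀‖ ^ β) (hbm.comp hnm)
    have hFm : Measurable fun x : Cov d => A.indicator (1 : ℝ → ℝ) ‖x - x₀‖ * ‖x - x₀‖ ^ β :=
      hind.mul (hbm.comp hnm)
    have hbound : ∀ x : Cov d, 0 ≤ A.indicator (1 : ℝ → ℝ) ‖x - x₀‖ * ‖x - x₀‖ ^ β ∧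
        A.indicator (1 : ℝ → ℝ) ‖x - x₀‖ * ‖x - x₀‖ ^ β ≤ 1 := by
      intro x
      by_cases hx : ‖x - x₀‖ ∈ A
      · simp only [hx, Set.indicator_of_mem, Pi.one_apply, one_mul]
        exact ⟨Real.rpow_nonneg (norm_nonneg _) _,
          Real.rpow_le_one (norm_nonneg _) ((hAI hx).2.trans hR.2.le) hβ.le⟩
      · simp [hx]
    have hμint := integrable_density_mul hQ hFm (integrable_of_abs_le (K := 1)
      (hFm.comp measurable_fst) fun z => by
        rw [abs_of_nonneg (hbound _).1]; exact (hbound _).2)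
    -- The bound `l ≤ μ` turns the Lebesgue integral of the error term into an integral against the
    -- law of the covariate; this is the source of `K / l`.
    have e3 : ∫ x : Cov d, A.indicator 1 ‖x‖ * ‖x‖ ^ β ≤
        1 / l * ∫ x, μ x * (A.indicator 1 ‖x - x₀‖ * ‖x - x₀‖ ^ β) := by
      rw [← integral_sub_right_eq_self (fun x : Cov d => A.indicator 1 ‖x‖ * ‖x‖ ^ β) x₀,
        ← integral_const_mul]
      refine integral_mono_of_nonneg (Filter.Eventually.of_forall fun x => (hbound x).1)
        (hμint.const_mul _) (Filter.Eventually.of_forall fun x => ?_)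
      dsimp only
      by_cases hx : ‖x - x₀‖ ∈ A
      · have h1 := hlow x (mem_closedBall_iff_norm.mpr (hAI hx).2)
        rw [← mul_assoc, one_div_mul_eq_div]
        exact le_mul_of_one_le_left (hbound x).1 ((one_le_div hl).mpr h1)
      · simp [hx]
    rw [e1, e2]
    refine (hexp A hA hAI).trans ?_
    calc _ ≤ K * (1 / l * ∫ x, μ x * (A.indicator 1 ‖x - x₀‖ * ‖x - x₀‖ ^ β)) := by gcongr
      _ = _ := by ring
  have hae : ∀ᵐ s ∂ν.restrict I, |m s - p.eval (s ^ 2)| ≤ K / l * s ^ β := by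
    have hrest : ∀ (A : Set ℝ), MeasurableSet A → ∀ F : ℝ → ℝ,
        ∫ s in A, F s ∂ν.restrict I = ∫ s in A ∩ I, F s ∂ν := fun A hA F => by
      rw [Measure.restrict_restrict hA]
    have hup := ae_le_of_forall_setIntegral_le (hintm.sub hintp) (hintb.const_mul (K / l))
      fun A hA _ => by
        rw [hrest A hA, hrest A hA]
        exact (le_abs_self _).trans (key _ (hA.inter hI) Set.inter_subset_right)
    have hdown := ae_le_of_forall_setIntegral_le (hintm.sub hintp).neg (hintb.const_mul (K / l))
      fun A hA _ => by
        rw [hrest A hA, hrest A hA]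
        refine le_trans ?_ (key _ (hA.inter hI) Set.inter_subset_right)
        simp only [Pi.neg_apply, Pi.sub_apply]
        rw [integral_neg]
        exact neg_le_abs _
    filter_upwards [hup, hdown] with s h1 h2
    rw [abs_le]
    constructor
    · have : -(m s - p.eval (s ^ 2)) ≤ K / l * s ^ β := h2
      linarith
    · exact h1
  rw [ae_restrict_iff' hI] at hae
  filter_upwards [ae_of_ae_map hρ.aemeasurable hae] with z hz hzR
  exact hz ⟨norm_nonneg _, hzR⟩

end Bias

/-- A single term `y ^ k / k!` of the exponential series suffices, with `k τ ≥ a`. -/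
lemma exists_exp_neg_rpow_le {c τ : ℝ} (hc : 0 < c) (hτ : 0 < τ) (a : ℝ) :
    ∃ K : ℝ, 0 ≤ K ∧ ∀ n : ℕ, 0 < n → Real.exp (-c * (n : ℝ) ^ τ) ≤ K * (n : ℝ) ^ (-a) := by
  let k := ⌈a / τ⌉₊
  have hk : a ≤ τ * k := by
    have := Nat.le_ceil (a / τ)
    rwa [div_le_iff₀ hτ, mul_comm] at this
  refine ⟨k.factorial / c ^ k, by positivity, fun n hn => ?_⟩
  have hn1 : (1 : ℝ) ≤ n := by exact_mod_cast hn
  have hn0 : (0 : ℝ) < n := by positivity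
  have hy : 0 < c * (n : ℝ) ^ τ := by positivity
  have h1 := Real.pow_div_factorial_le_exp _ hy.le k
  have h2 : (n : ℝ) ^ a ≤ ((n : ℝ) ^ τ) ^ k := by
    rw [← Real.rpow_natCast, ← Real.rpow_mul hn0.le]
    exact Real.rpow_le_rpow_of_exponent_le hn1 hk
  rw [neg_mul, Real.exp_neg, Real.rpow_neg hn0.le]
  calc (Real.exp (c * (n : ℝ) ^ τ))⁻¹ ≤ ((c * (n : ℝ) ^ τ) ^ k / k.factorial)⁻¹ := by gcongr
    _ = k.factorial / c ^ k * (((n : ℝ) ^ τ) ^ k)⁻¹ := by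
        rw [mul_pow]; field_simp
    _ ≤ _ := by gcongr

/-! ### Almost sure regularity and the bias-variance bound -/

section Model

variable {d : ℕ} {Q : Measure (Cov d × ℝ)} {μ η : Cov d → ℝ}

lemma measure_dist₀_eq_zero (hd : 0 < d) (hQ : IsLabelModel Q μ η) (x₀ : Cov d) (s : ℝ) :
    Q {z | dist₀ x₀ z = s} = 0 := by
  have : Nontrivial (Cov d) := by
    have : Nonempty (Fin d) := ⟨⟨0, hd⟩⟩
    infer_instance
  have h1 : {z : Cov d × ℝ | dist₀ x₀ z = s} = Prod.fst ⁻¹' Metric.sphere x₀ s := by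
    ext z; simp [dist₀]
  rw [h1, ← Measure.map_apply measurable_fst Metric.isClosed_sphere.measurableSet, hQ.density]
  exact withDensity_absolutelyContinuous _ _ (Measure.addHaar_sphere _ _ _)

/-- The small ball probabilities are at least of the order of the volume. -/
lemma exists_le_measure_dist₀_le [IsProbabilityMeasure Q] (hQ : IsLabelModel Q μ η)
    {x₀ : Cov d} {R : ℝ} (hlow : LowerBoundedOnBall x₀ R μ) :
    ∃ v : ℝ, 0 < v ∧ ∀ r, 0 ≤ r → r ≤ R → v * r ^ d ≤ Q.real {z | dist₀ x₀ z ≤ r} := by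
  obtain ⟨l, hl, hlow⟩ := hlow
  refine ⟨l * (volume : Measure (Cov d)).real (Metric.closedBall 0 1), ?_, fun r hr0 hr => ?_⟩
  · refine mul_pos hl (ENNReal.toReal_pos ?_ measure_closedBall_lt_top.ne)
    exact (Metric.measure_closedBall_pos _ _ one_pos).ne'
  have hB : MeasurableSet (Metric.closedBall x₀ r) := Metric.isClosed_closedBall.measurableSet
  have h1 : {z : Cov d × ℝ | dist₀ x₀ z ≤ r} = Prod.fst ⁻¹' Metric.closedBall x₀ r := by
    ext z; simp [dist₀, dist_eq_norm]
  have h2 : ENNReal.ofReal l * volume (Metric.closedBall x₀ r) ≤ Q {z | dist₀ x₀ z ≤ r} := by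
    rw [h1, ← Measure.map_apply measurable_fst hB, hQ.density, withDensity_apply _ hB,
      ← setLIntegral_const]
    exact setLIntegral_mono' hB fun x hx =>
      ENNReal.ofReal_le_ofReal (hlow x (Metric.closedBall_subset_closedBall hr hx))
  have h3 := ENNReal.toReal_mono (measure_ne_top _ _) h2
  rw [ENNReal.toReal_mul, ENNReal.toReal_ofReal hl.le, ← measureReal_def, ← measureReal_def,
    Measure.addHaar_real_closedBall' _ _ hr0] at h3
  simp only [finrank_euclideanSpace, Fintype.card_fin] at h3
  linarith

variable [IsProbabilityMeasure Q]

lemma ae_forall_coord {n : ℕ} {p : Cov d × ℝ → Prop} (hp : ∀ᵐ z ∂Q, p z) :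
    ∀ᵐ D ∂dataLaw Q n, ∀ i, p (D i) := by
  rw [ae_all_iff]
  intro i
  exact (measurePreserving_eval (fun _ : Fin n => Q) i).quasiMeasurePreserving.ae hp

/-- The distance has an atomless law, so the radii are almost surely distinct and nonzero. -/
lemma ae_det_gram_ne_zero (hd : 0 < d) (hQ : IsLabelModel Q μ η) (x₀ : Cov d) (n ω : ℕ) (r : ℝ) :
    ∀ᵐ D ∂dataLaw Q n, (ω : ℝ) ≤ count r (radial x₀ D) → (gram ω r (radial x₀ D)).det ≠ 0 := by
  have hne : ∀ᵐ D ∂dataLaw Q n, ∀ i j, i ≠ j → radial x₀ D i ≠ radial x₀ D j := by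
    simp_rw [ae_all_iff]
    intro i j hij
    exact ae_ne_of_noAtoms Q (measurable_dist₀ x₀) (measure_dist₀_eq_zero hd hQ x₀) hij
  have hpos : ∀ᵐ D ∂dataLaw Q n, ∀ i, dist₀ x₀ (D i) ≠ 0 :=
    ae_forall_coord (p := fun z => dist₀ x₀ z ≠ 0) (by
      rw [ae_iff]; simpa using measure_dist₀_eq_zero hd hQ x₀ 0)
  filter_upwards [hne, hpos] with D h1 h2 hc
  refine det_gram_ne_zero ω r _ (fun i j hij => ?_) (fun i => ?_) hc
  · by_contra h; exact h1 i j h hij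
  · exact (norm_nonneg _).lt_of_ne' (h2 i)

/-- The estimator as a linear smoother of the label indicators. -/
def smoother {n : ℕ} (ω : ℕ) (φ : ℝ) (x₀ : Cov d) (r : ℝ) (D : Data d n) : ℝ :=
  ∑ i, lrrWeight ω φ r (radial x₀ D) i * labelInd (D i)

/-- `lrr` involves an arbitrary choice of minimizer; the smoother is a measurable and bounded
version of it. -/
lemma ae_lrr_eq_smoother (hd : 0 < d) (hQ : IsLabelModel Q μ η) (x₀ : Cov d) (n ω : ℕ) {φ : ℝ}
    (hφ : φ < 1) (r : ℝ) :
    ∀ᵐ D ∂dataLaw Q n, lrr ω φ x₀ r D = smoother ω φ x₀ r D := by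
  have hlab : ∀ᵐ D ∂dataLaw Q n, ∀ i, (D i).2 = 0 ∨ (D i).2 = 1 := ae_forall_coord hQ.label
  filter_upwards [ae_det_gram_ne_zero hd hQ x₀ n ω r, hlab] with D hdet hl
  rw [lrr_eq_sum ω x₀ r D hφ hdet]
  refine Finset.sum_congr rfl fun i _ => ?_
  congr 1
  unfold labelInd
  rcases hl i with h | h <;> simp [h]

omit [IsProbabilityMeasure Q] in
lemma measurable_radial (x₀ : Cov d) (n : ℕ) :
    Measurable fun D : Data d n => radial x₀ D :=
  measurable_pi_lambda _ fun i => (measurable_dist₀ x₀).comp (measurable_pi_apply i)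

lemma measurable_smoother (ω n : ℕ) (φ : ℝ) (x₀ : Cov d) (r : ℝ) :
    Measurable (smoother ω φ x₀ r : Data d n → ℝ) :=
  Finset.measurable_fun_sum _ fun i _ =>
    Measurable.fun_mul ((measurable_lrrWeight ω r φ i).comp (measurable_radial x₀ n))
      (measurable_labelInd.comp (measurable_pi_apply i))

/-- A crude bound for every data set, used for integrability and for the finitely many `n` whose
radius exceeds `R`. -/
lemma sq_sub_smoother_le {n : ℕ} (ω : ℕ) {φ : ℝ} (hφ : φ < 1) (x₀ : Cov d) (r t : ℝ)
    (D : Data d n) : (t - smoother ω φ x₀ r D) ^ 2 ≤ 2 * t ^ 2 + 2 * (1 / (1 - φ)) := by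
  have h1 : smoother ω φ x₀ r D ^ 2 ≤ 1 ^ 2 / (1 - φ) :=
    sq_sum_lrrWeight_mul_le ω r (radial x₀ D) hφ _ fun i _ => by
      unfold labelInd; split_ifs <;> norm_num
  rw [one_pow] at h1
  nlinarith [sq_nonneg (t + smoother ω φ x₀ r D)]

/-- The bias-variance decomposition of the smoother. -/
lemma integral_sq_sub_smoother_le (hd : 0 < d) (hQ : IsLabelModel Q μ η) {x₀ : Cov d} {n ω : ℕ}
    {φ r β C : ℝ} (hφ : φ ∈ Set.Ioo (0 : ℝ) 1) (hβ : 0 < β) (hC : 0 ≤ C)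
    {m : ℝ → ℝ} (hm : Measurable m) (hm01 : ∀ s, 0 ≤ m s ∧ m s ≤ 1)
    (hcent : ∀ g : ℝ → ℝ, Measurable g → (∃ B, ∀ s, |g s| ≤ B) →
      ∫ z, g (dist₀ x₀ z) * (labelInd z - m (dist₀ x₀ z)) ∂Q = 0)
    {t : ℝ} {θ : Fin ω → ℝ} (hbias : ∀ᵐ z ∂Q, dist₀ x₀ z ≤ r →
      |m (dist₀ x₀ z) - (t + ∑ a, θ a * dist₀ x₀ z ^ (2 * ((a : ℕ) + 1)))| ≤
        C * dist₀ x₀ z ^ β) :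
    ∫ D, (t - smoother ω φ x₀ r D) ^ 2 ∂dataLaw Q n ≤
      (4 / (1 - φ) + (2 + ω) * t ^ 2) *
          ∫ D, 1 / (1 + count r (radial x₀ D)) ∂dataLaw Q n +
        2 * ((C * r ^ β) ^ 2 / (1 - φ)) +
        t ^ 2 * (dataLaw Q n).real {D | φ * numInBall x₀ r D ≤ zeta ω x₀ r D} := by
  have hφ' : 0 < 1 - φ := by linarith [hφ.2]
  have hρ := measurable_radial x₀ n
  let S : Set (Data d n) := {D | φ * numInBall x₀ r D ≤ zeta ω x₀ r D}
  have hS : MeasurableSet S := by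
    have : S = {D | φ * count r (radial x₀ D) ≤ projOne ω r (radial x₀ D)} := by
      ext D
      change φ * (numInBall x₀ r D : ℝ) ≤ zeta ω x₀ r D ↔ _
      rw [numInBall_eq_count, zeta_eq_projOne]
      rfl
    rw [this]
    exact measurableSet_le (((measurable_count r).comp hρ).const_mul φ)
      ((measurable_projOne ω r).comp hρ)
  let e : Cov d × ℝ → ℝ := fun z => labelInd z - m (dist₀ x₀ z)
  have he : Measurable e := measurable_labelInd.sub (hm.comp (measurable_dist₀ x₀))
  have he1 : ∀ z, |e z| ≤ 1 := fun z => by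
    have := hm01 (dist₀ x₀ z)
    simp only [e, labelInd, abs_le]
    split_ifs <;> constructor <;> linarith
  let V : Data d n → ℝ := fun D => (∑ i, lrrWeight ω φ r (radial x₀ D) i * e (D i)) ^ 2
  let J : Data d n → ℝ := fun D => 1 / (1 + count r (radial x₀ D))
  have hVm : Measurable V := (Finset.measurable_fun_sum _ fun i _ =>
    Measurable.fun_mul ((measurable_lrrWeight ω r φ i).comp hρ)
      (he.comp (measurable_pi_apply i))).pow_const 2
  have hVint : Integrable V (dataLaw Q n) :=
    integrable_of_abs_le (K := 1 ^ 2 / (1 - φ)) hVm fun D => by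
      rw [abs_of_nonneg (sq_nonneg _)]
      exact sq_sum_lrrWeight_mul_le ω r (radial x₀ D) hφ.2 _ fun i _ => he1 _
  have hJ0 : ∀ D, 0 ≤ J D := fun D => by
    have := count_nonneg r (radial x₀ D)
    simp only [J]; positivity
  have hJint : Integrable J (dataLaw Q n) :=
    integrable_of_abs_le (K := 1) (measurable_const.div (((measurable_count r).comp hρ).const_add 1))
      fun D => by
        have := count_nonneg r (radial x₀ D)
        rw [abs_of_nonneg (hJ0 D)]
        simp only [J]
        rw [div_le_one (by positivity)]
        linarith
  have hVle : ∫ D, V D ∂dataLaw Q n ≤ 2 / (1 - φ) * ∫ D, J D ∂dataLaw Q n := by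
    have h1 := integral_sq_sum_weight_mul_error_le Q (n := n) (measurable_dist₀ x₀) he he1 hcent
      (w := fun i ρ => lrrWeight ω φ r ρ i) (M := 2 / (1 - φ))
      (fun i => measurable_lrrWeight ω r φ i) (fun i ρ => abs_lrrWeight_le ω r ρ hφ i)
    refine h1.trans ?_
    rw [← integral_const_mul]
    exact integral_mono_of_nonneg
      (Filter.Eventually.of_forall fun D => Finset.sum_nonneg fun i _ => sq_nonneg _)
      (hJint.const_mul _)
      (Filter.Eventually.of_forall fun D => sum_lrrWeight_sq_le ω r (radial x₀ D) hφ.2)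
  have hSint : Integrable (S.indicator 1 : Data d n → ℝ) (dataLaw Q n) :=
    (integrable_indicator_iff hS).mpr (integrable_const (1 : ℝ)).integrableOn
  have hS0 : ∀ D, 0 ≤ (S.indicator 1 : Data d n → ℝ) D := fun D =>
    Set.indicator_nonneg (fun _ _ => zero_le_one) D
  have hpt : ∀ᵐ D ∂dataLaw Q n, (t - smoother ω φ x₀ r D) ^ 2 ≤
      2 * V D + 2 * ((C * r ^ β) ^ 2 / (1 - φ)) +
        (t ^ 2 * ((2 + ω) * J D) + t ^ 2 * S.indicator 1 D) := by
    filter_upwards [ae_det_gram_ne_zero hd hQ x₀ n ω r, ae_forall_coord hbias] with D hdet hb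
    by_cases hreg : Regular ω φ r (radial x₀ D)
    · let ε : Fin n → ℝ := fun i => m (radial x₀ D i) -
        (t + ∑ a, θ a * radial x₀ D i ^ (2 * ((a : ℕ) + 1)))
      -- Exactness removes `t` and the even polynomial, which leaves the noise `e` and the expansion
      -- error `ε`.
      have hdec : smoother ω φ x₀ r D - t =
          ∑ i, lrrWeight ω φ r (radial x₀ D) i * e (D i) +
            ∑ i, lrrWeight ω φ r (radial x₀ D) i * ε i := by
        rw [← sum_lrrWeight_mul_even ω r (radial x₀ D) hφ.2 hreg t θ, smoother,
          ← Finset.sum_sub_distrib, ← Finset.sum_add_distrib]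
        refine Finset.sum_congr rfl fun i _ => ?_
        have : dist₀ x₀ (D i) = radial x₀ D i := rfl
        simp only [e, ε, this]
        ring
      have hε : (∑ i, lrrWeight ω φ r (radial x₀ D) i * ε i) ^ 2 ≤ (C * r ^ β) ^ 2 / (1 - φ) :=
        sq_sum_lrrWeight_mul_le ω r (radial x₀ D) hφ.2 ε fun i hi =>
          (hb i hi).trans (mul_le_mul_of_nonneg_left
            (Real.rpow_le_rpow (norm_nonneg _) hi hβ.le) hC)
      have h1 : (t - smoother ω φ x₀ r D) ^ 2 ≤ 2 * V D + 2 * ((C * r ^ β) ^ 2 / (1 - φ)) := by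
        rw [← neg_sq, neg_sub, hdec]
        simp only [V]
        nlinarith [sq_nonneg (∑ i, lrrWeight ω φ r (radial x₀ D) i * e (D i) -
            ∑ i, lrrWeight ω φ r (radial x₀ D) i * ε i)]
      have h2 : 0 ≤ t ^ 2 * ((2 + ω) * J D) := by have := hJ0 D; positivity
      have h3 : 0 ≤ t ^ 2 * S.indicator 1 D := mul_nonneg (sq_nonneg _) (hS0 D)
      linarith
    · have hs0 : smoother ω φ x₀ r D = 0 := by
        unfold smoother
        exact Finset.sum_eq_zero fun i _ => by rw [lrrWeight_of_not ω r _ hreg, zero_mul]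
      -- Either `N < 1 + ω`, and then `1 + N ≤ 2 + ω`, or the Gram matrix is nonsingular and
      -- irregularity forces `ζ > φ N`.
      have hbad : 1 ≤ (2 + ω) * J D + S.indicator 1 D := by
        by_cases hc : 1 + (ω : ℝ) ≤ count r (radial x₀ D)
        · have hDS : D ∈ S := by
            change φ * (numInBall x₀ r D : ℝ) ≤ zeta ω x₀ r D
            rw [numInBall_eq_count, zeta_eq_projOne]
            by_contra! hlt
            exact hreg ⟨hdet (by linarith), hc, hlt.le⟩
          rw [Set.indicator_of_mem hDS, Pi.one_apply]
          have := hJ0 D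
          have : 0 ≤ (2 + (ω : ℝ)) * J D := by positivity
          linarith
        · have h1 := count_nonneg r (radial x₀ D)
          have h2 : 1 ≤ (2 + (ω : ℝ)) * J D := by
            simp only [J]
            rw [mul_one_div, one_le_div (by positivity)]
            linarith
          linarith [hS0 D]
      have hV0 : 0 ≤ V D := sq_nonneg _
      have hB0 : 0 ≤ (C * r ^ β) ^ 2 / (1 - φ) := by positivity
      have h4 := mul_le_mul_of_nonneg_left hbad (sq_nonneg t)
      rw [hs0, sub_zero]
      linarith
  have hbound : Integrable (fun D => 2 * V D + 2 * ((C * r ^ β) ^ 2 / (1 - φ)) +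
      (t ^ 2 * ((2 + ω) * J D) + t ^ 2 * S.indicator 1 D)) (dataLaw Q n) :=
    ((hVint.const_mul 2).fun_add (integrable_const _)).fun_add
      (((hJint.const_mul _).const_mul _).fun_add (hSint.const_mul _))
  have hfin := integral_mono_of_nonneg
    (Filter.Eventually.of_forall fun D => sq_nonneg (t - smoother ω φ x₀ r D)) hbound hpt
  have hval : ∫ D, (2 * V D + 2 * ((C * r ^ β) ^ 2 / (1 - φ)) +
      (t ^ 2 * ((2 + ω) * J D) + t ^ 2 * S.indicator 1 D)) ∂dataLaw Q n =
      2 * ∫ D, V D ∂dataLaw Q n + 2 * ((C * r ^ β) ^ 2 / (1 - φ)) +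
        (t ^ 2 * ((2 + ω) * ∫ D, J D ∂dataLaw Q n) + t ^ 2 * (dataLaw Q n).real S) := by
    rw [integral_add ((hVint.const_mul 2).fun_add (integrable_const _))
        (((hJint.const_mul _).const_mul _).fun_add (hSint.const_mul _)),
      integral_add (hVint.const_mul 2) (integrable_const _),
      integral_add ((hJint.const_mul _).const_mul _) (hSint.const_mul _),
      integral_const, integral_const_mul, integral_const_mul, integral_const_mul,
      integral_const_mul, integral_indicator_one hS]
    simp
  rw [hval] at hfin
  refine hfin.trans ?_
  have : (4 / (1 - φ) + (2 + ω) * t ^ 2) * ∫ D, J D ∂dataLaw Q n =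
      2 * (2 / (1 - φ) * ∫ D, J D ∂dataLaw Q n) +
        t ^ 2 * ((2 + ω) * ∫ D, J D ∂dataLaw Q n) := by ring
  change _ ≤ (4 / (1 - φ) + (2 + ω) * t ^ 2) * ∫ D, J D ∂dataLaw Q n + _ + _ *
    (dataLaw Q n).real S
  linarith

end Model

/-- The strict floor satisfies `ω + 1 = ⌈β / 2⌉`, also when `β / 2` is an integer. -/
lemma le_two_mul_strictFloor_half_add_one {β : ℝ} (hβ : 0 < β) :
    β ≤ 2 * ((strictFloor (β / 2) : ℝ) + 1) := by
  have h1 : 0 < ⌈β / 2⌉₊ := Nat.ceil_pos.mpr (by positivity)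
  have h2 : ((strictFloor (β / 2) : ℝ) + 1) = ⌈β / 2⌉₊ := by
    unfold strictFloor
    rw [← Nat.cast_add_one, Nat.sub_add_cancel h1]
  linarith [Nat.le_ceil (β / 2)]

end LocalRadial

end

/-! ### The rate of convergence -/

theorem corollary1 {d : ℕ} (hd : 0 < d) {β R φ : ℝ} (hβ : 0 < β)
    (hR : R ∈ Set.Ioo (0 : ℝ) 1) (hφ : φ ∈ Set.Ioo (0 : ℝ) 1)
    (Q : Measure (LocalRadial.Cov d × ℝ)) [IsProbabilityMeasure Q]
    (μ η : LocalRadial.Cov d → ℝ) (hQ : LocalRadial.IsLabelModel Q μ η)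
    (x₀ : LocalRadial.Cov d)
    (hC1 : LocalRadial.LowerBoundedOnBall x₀ R μ)
    (hC2 : LocalRadial.HolderOnBall β x₀ R μ ∧
      LocalRadial.HolderOnBall β x₀ R (fun x => η x * μ x))
    (hC3 : LocalRadial.ZetaConcentration Q β φ x₀ (LocalRadial.optRadius d β)) :
    ∃ C : ℝ, 0 < C ∧ ∀ n : ℕ, 0 < n →
      Integrable (fun D : LocalRadial.Data d n =>
        (η x₀ - LocalRadial.lrr (LocalRadial.strictFloor (β / 2)) φ x₀
          (LocalRadial.optRadius d β n) D) ^ 2) (LocalRadial.dataLaw Q n) ∧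
      ∫ D, (η x₀ - LocalRadial.lrr (LocalRadial.strictFloor (β / 2)) φ x₀
          (LocalRadial.optRadius d β n) D) ^ 2 ∂(LocalRadial.dataLaw Q n) ≤
        C * (n : ℝ) ^ (-(2 * β) / ((d : ℝ) + 2 * β)) := by
  open LocalRadial in
  have hφ' : 0 < 1 - φ := by linarith [hφ.2]
  set ω := strictFloor (β / 2)
  set t := η x₀
  obtain ⟨m, hm, hm01, hcent, hηint, hset⟩ := exists_radial_prob x₀ hQ
  obtain ⟨θ, C₀, hC₀, hbias⟩ := ae_abs_radial_prob_sub_le hd hβ hR hQ hC1 hC2.1 hC2.2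
    (le_two_mul_strictFloor_half_add_one hβ) hm hm01 hηint hset
  obtain ⟨v, hv, hvol⟩ := exists_le_measure_dist₀_le hQ hC1
  obtain ⟨c, C₁, τ, hc, hC₁, hτ, hconc⟩ := hC3
  obtain ⟨K, hK, hexp⟩ := exists_exp_neg_rpow_le hc hτ (2 * β / ((d : ℝ) + 2 * β))
  have hden : 0 < (d : ℝ) + 2 * β := by positivity
  set B := 2 * t ^ 2 + 2 * (1 / (1 - φ))
  have hB : 0 < B := by positivity
  -- The three summands bound the variance together with the event of too few points, the squared
  -- bias, and the event of large `ζ`.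
  set E := (4 / (1 - φ) + (2 + ω) * t ^ 2) * (1 / v) + 2 * (C₀ ^ 2 / (1 - φ)) +
    t ^ 2 * (C₁ * K)
  have hE : 0 ≤ E := by positivity
  have hRβ : 0 < R ^ (2 * β) := Real.rpow_pos_of_pos hR.1 _
  refine ⟨B / R ^ (2 * β) + E, by positivity, fun n hn => ?_⟩
  set r := optRadius d β n with hrdef
  set rate := (n : ℝ) ^ (-(2 * β) / ((d : ℝ) + 2 * β)) with hrate
  have hn0 : (0 : ℝ) < n := by exact_mod_cast hn
  have hrate0 : 0 < rate := Real.rpow_pos_of_pos hn0 _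
  have hr0 : 0 < r := Real.rpow_pos_of_pos hn0 _
  have hr2β : r ^ (2 * β) = rate := by
    rw [hrdef, optRadius, ← Real.rpow_mul hn0.le]
    congr 1
    ring
  -- The choice of the radius balances the variance `1 / (n r ^ d)` and the squared bias `r ^ (2β)`.
  have hrd : (n : ℝ) * r ^ d = rate⁻¹ := by
    rw [hrdef, optRadius, ← Real.rpow_natCast, ← Real.rpow_mul hn0.le, hrate,
      ← Real.rpow_neg hn0.le]
    nth_rewrite 1 [← Real.rpow_one (n : ℝ)]
    rw [← Real.rpow_add hn0]
    congr 1
    field_simp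
    ring
  have hae : (fun D : Data d n => (t - smoother ω φ x₀ r D) ^ 2) =ᵐ[dataLaw Q n]
      fun D => (t - lrr ω φ x₀ r D) ^ 2 := by
    filter_upwards [ae_lrr_eq_smoother hd hQ x₀ n ω hφ.2 r] with D hD
    rw [hD]
  have hint : Integrable (fun D : Data d n => (t - smoother ω φ x₀ r D) ^ 2) (dataLaw Q n) :=
    integrable_of_abs_le (K := B) ((measurable_const.sub (measurable_smoother ω n φ x₀ r)).pow_const 2)
      fun D => by
        rw [abs_of_nonneg (sq_nonneg _)]
        exact sq_sub_smoother_le ω hφ.2 x₀ r t D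
  refine ⟨hint.congr hae, ?_⟩
  rw [← integral_congr_ae hae, add_mul]
  rcases le_or_gt r R with hrR | hrR
  · have h1 := integral_sq_sub_smoother_le (n := n) (ω := ω) hd hQ hφ hβ hC₀ hm hm01 hcent
      (hbias.mono fun z hz hzr => hz (hzr.trans hrR))
    have h2 : ∫ D, 1 / (1 + count r (radial x₀ D)) ∂dataLaw Q n ≤ 1 / v * rate := by
      have h3 := mul_integral_inv_one_add_count_le Q (n := n) (measurable_dist₀ x₀) r
      have h4 : v * rate⁻¹ ≤ (n : ℝ) * Q.real {z | dist₀ x₀ z ≤ r} := by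
        rw [← hrd]
        nlinarith [mul_le_mul_of_nonneg_left (hvol r hr0.le hrR) hn0.le]
      have h5 : 0 ≤ ∫ D, 1 / (1 + count r (radial x₀ D)) ∂dataLaw Q n :=
        integral_nonneg fun D => by
          have := count_nonneg r (radial x₀ D)
          change 0 ≤ 1 / (1 + count r (radial x₀ D))
          positivity
      have h6 : v * rate⁻¹ * ∫ D, 1 / (1 + count r (radial x₀ D)) ∂dataLaw Q n ≤ 1 :=
        (mul_le_mul_of_nonneg_right h4 h5).trans h3
      rw [mul_comm, ← le_div_iff₀ (by positivity)] at h6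
      refine h6.trans (le_of_eq ?_)
      field_simp
    have h7 : (C₀ * r ^ β) ^ 2 = C₀ ^ 2 * rate := by
      rw [mul_pow, ← Real.rpow_mul_natCast hr0.le, ← hr2β]
      congr 2
      push_cast
      ring
    have h8 : (dataLaw Q n).real {D | φ * numInBall x₀ r D ≤ zeta ω x₀ r D} ≤
        C₁ * (K * rate) := by
      refine (hconc n hn).trans (mul_le_mul_of_nonneg_left ?_ hC₁.le)
      have := hexp n hn
      rwa [← neg_div] at this
    refine h1.trans ?_
    rw [h7]
    have h9 : 0 ≤ B / R ^ (2 * β) * rate := by positivity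
    calc _ ≤ (4 / (1 - φ) + (2 + ω) * t ^ 2) * (1 / v * rate) +
          2 * (C₀ ^ 2 * rate / (1 - φ)) + t ^ 2 * (C₁ * (K * rate)) := by gcongr
      _ = E * rate := by simp only [E]; ring
      _ ≤ _ := by linarith
  -- For a radius beyond `R` the expansion is not available; but then the rate is at least `R ^
  -- (2β)`, and the crude bound suffices.
  · have h1 : ∫ D, (t - smoother ω φ x₀ r D) ^ 2 ∂dataLaw Q n ≤ B := by
      refine (integral_mono hint (integrable_const B)
        fun D => sq_sub_smoother_le ω hφ.2 x₀ r t D).trans ?_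
      simp
    have h2 : R ^ (2 * β) ≤ rate := by
      rw [← hr2β]; exact Real.rpow_le_rpow hR.1.le hrR.le (by positivity)
    have h3 : B ≤ B / R ^ (2 * β) * rate := by
      rw [div_mul_eq_mul_div, le_div_iff₀ hRβ]
      exact mul_le_mul_of_nonneg_left h2 hB.le
    have h4 : 0 ≤ E * rate := by positivity
    linarith
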